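/- For $1\le r\le 2$ and a measurable function $h:\mathbb{R}^2\to\mathbb{C}$ let $M_r h(x)=\big(M(|h|^r)(x)\big)^{1/r}$, where $Mg(x)=\sup_{t>0}\frac1{|B(x,t)|}\int_{B(x,t)}|g|$ is the Hardy--Littlewood maximal function. Let $1\le p<\frac43$ and let $p'$ be the conjugate exponent, $\frac1p+\frac1{p'}=1$. Then there is a finite constant $C_{p,r}$, depending only on $p$ and $r$, such that for every $1\le q\le\infty$ with $p'\ge 3q$ and every $f\in L^p(\mathbb{R}^2)$, $$\|M_r(\widehat f)\|_{L^q(\mathbb{S}^1)}\le C_{p,r}\,\|f\|_{L^p(\mathbb{R}^2)}.$$ Here $\mathbb{S}^1\subset\mathbb{R}^2$ is the unit circle with arc length measure, and $\widehat f$ is the Fourier transform of $f$, normalized by $\widehat f(\xi)=\int_{\mathbb{R}^2}e^{-2\pi i x\cdot\xi}f(x)\,dx$ for $f\in L^1(\mathbb{R}^2)$ and extended to $L^p(\mathbb{R}^2)\subset L^1(\mathbb{R}^2)+L^2(\mathbb{R}^2)$ by linearity and Plancherel's theorem. -/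

import Mathlib

open MeasureTheory FourierTransform
open scoped ENNReal NNReal

noncomputable section

/-- The Euclidean plane `ℝ²`. -/
abbrev Plane : Type := EuclideanSpace ℝ (Fin 2)

/-- The (centred) Hardy–Littlewood maximal function
`M f (x) = sup_{t > 0} |B(x,t)|⁻¹ ∫_{B(x,t)} |f|`, with values in `[0, ∞]`. -/
def hlMaximal (f : Plane → ℝ) (x : Plane) : ℝ≥0∞ :=
  ⨆ (t : ℝ) (_ : 0 < t), ⨍⁻ y in Metric.ball x t, ‖f y‖ₑ ∂volume

/-- The `r`-average maximal function `M_r h = (M (|h|^r))^{1/r}`. -/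
def rMaximal (r : ℝ) (h : Plane → ℂ) (x : Plane) : ℝ≥0∞ :=
  hlMaximal (fun y => ‖h y‖ ^ r) x ^ (1 / r)

open Classical in
/-- The Plancherel extension of the Fourier transform to `L²(ℝ²)`, as a map on functions
(the value is a representative; it is `0` by convention outside `L²`). -/
def fourierPlaneL2 (f : Plane → ℂ) : Plane → ℂ :=
  if hf : MemLp f 2 volume then ⇑(𝓕 (hf.toLp f) : Lp (α := Plane) ℂ 2 volume) else 0

/-- The Fourier transform on `L^p(ℝ²)`, `1 ≤ p ≤ 2`, defined as usual through
`L^p ⊆ L¹ + L²`: the integrable part `f · 1_{|f| > 1}` is transformed by the Fourier integral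
`∫ e^{-2πi x·ξ} f(x) dx`, the square integrable part `f · 1_{|f| ≤ 1}` by Plancherel extension.
The result is well defined up to null sets. -/
def fourierPlane (f : Plane → ℂ) : Plane → ℂ :=
  𝓕 ({x | 1 < ‖f x‖}.indicator f) + fourierPlaneL2 ({x | ‖f x‖ ≤ 1}.indicator f)

/-- Arc length measure `σ` on the unit circle `𝕊¹ ⊆ ℝ²` (total mass `2π`), the image of
Lebesgue measure under the unit speed parametrization `θ ↦ (cos θ, sin θ)`, `0 < θ ≤ 2π`. -/
def circleMeasure : Measure Plane :=
  Measure.map (fun θ : ℝ => (!₂[Real.cos θ, Real.sin θ] : Plane))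
    (volume.restrict (Set.Ioc 0 (2 * Real.pi)))

end

/-! ### Power integrals and the layer-cake formula. -/

section LayerCake

/-! The estimate is linearized, dualized and then squared, as in the classical proof of the
restriction theorem for the circle. Put s = p/(2-p). Then p = 2s/(s+1), p' = 2s/(s-1), and 1 < p <
4/3 becomes 1 < s < 2. The critical exponent is q = p'/3 = 2s/(3(s-1)), with conjugate q' =
2s/(3-s). Smaller q follow by Hölder on the circle, and p = 1 is the trivial bound of the transform
by the L¹ norm.

Linearization: since r ≤ 2, the operator is dominated by quadratic means over balls of dyadic
radius. By monotone convergence finitely many radii suffice, and then the best radius ρ(θ) is a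
measurable choice (`exists_measurable_radius_quadraticMean_eq_partialSups`).

Duality: let A(θ) be the quadratic mean of the transform F of f over the ball of radius ρ(θ) about
e^{iθ}. Then ∫ A^q = ∫ F G, where |G| is at most a superposition Γ = ∫ A(θ)^{q-1} κ_θ dθ of kernels
supported in these balls and normalized in L². The multiplication formula moves the transform onto
G, and what remains is an L^{p'} bound for it
(`lintegral_enorm_fourier_rpow_le_of_le_superposition`).

Squaring: the square of the transform of G is the transform of G * G, so Hausdorff–Young reduces the
bound to the L^s norm of N = Γ * Γ (`lintegral_lconvolution_rpow_le`). Tested against h = N^{s-1}, a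
pair κ_θ, κ_θ' gives at most twice the quadratic maximal function of h at e^{iθ} + e^{iθ'}:
Cauchy–Schwarz is spent on the larger ball, and only the mass of the other kernel is used. That
maximal function is bounded on L^{s/(s-1)} because s/(s-1) > 2, that is, because p < 4/3.

Bilinear estimate: the sum map on pairs of angles is at most two-to-one off the zeros of its
Jacobian |sin(θ-θ')|. Hölder with that weight leaves a kernel |sin(θ-θ')|^{-(s-1)}, controlled by
Hardy–Littlewood–Sobolev (`setLIntegral_mul_mul_comp_add_le`). -/

theorem lintegral_Ioo_rpow {b c : ℝ} (hb : -1 < b) (hc : 0 ≤ c) :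
    ∫⁻ x in Set.Ioo 0 c, ENNReal.ofReal (x ^ b) = ENNReal.ofReal (c ^ (b + 1) / (b + 1)) := by
  have hi : IntegrableOn (fun x : ℝ => x ^ b) (Set.Ioc 0 c) := by
    have := intervalIntegral.intervalIntegrable_rpow' (a := 0) (b := c) hb
    rwa [intervalIntegrable_iff_integrableOn_Ioc_of_le hc] at this
  rw [setLIntegral_congr Ioo_ae_eq_Ioc, ← ofReal_integral_eq_lintegral_ofReal hi,
    ← intervalIntegral.integral_of_le hc, integral_rpow (Or.inl hb),
    Real.zero_rpow (by linarith), sub_zero]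
  filter_upwards [ae_restrict_mem measurableSet_Ioc] with x hx
  exact Real.rpow_nonneg hx.1.le _

theorem lintegral_Ioi_rpow {b c : ℝ} (hb : b < -1) (hc : 0 < c) :
    ∫⁻ x in Set.Ioi c, ENNReal.ofReal (x ^ b) = ENNReal.ofReal (-c ^ (b + 1) / (b + 1)) := by
  rw [← ofReal_integral_eq_lintegral_ofReal (integrableOn_Ioi_rpow_of_lt hb hc),
    integral_Ioi_rpow_of_lt hb hc]
  filter_upwards [ae_restrict_mem measurableSet_Ioi] with x hx
  exact Real.rpow_nonneg (hc.trans hx).le _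

theorem lintegral_rpow_of_ofReal_lt {b : ℝ} (hb : -1 < b) (F : ℝ≥0∞) :
    ∫⁻ x in Set.Ioi (0 : ℝ), {x : ℝ | ENNReal.ofReal x < F}.indicator
      (fun x => ENNReal.ofReal (x ^ b)) x = F ^ (b + 1) / ENNReal.ofReal (b + 1) := by
  have hb' : 0 < b + 1 := by linarith
  have key : ∀ c : ℝ, 0 ≤ c → ∫⁻ x in Set.Ioi (0 : ℝ),
      {x : ℝ | ENNReal.ofReal x < ENNReal.ofReal c}.indicator
      (fun x => ENNReal.ofReal (x ^ b)) x
        = ENNReal.ofReal c ^ (b + 1) / ENNReal.ofReal (b + 1) := by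
    intro c hc
    rw [ENNReal.ofReal_rpow_of_nonneg hc hb'.le, ← ENNReal.ofReal_div_of_pos hb',
      ← lintegral_Ioo_rpow hb hc, ← lintegral_indicator measurableSet_Ioi,
      ← lintegral_indicator measurableSet_Ioo]
    congr 1 with x
    by_cases hx : 0 < x
    · by_cases hxc : x < c <;>
        simp [Set.indicator, hx, hxc, ENNReal.ofReal_lt_ofReal_iff_of_nonneg hx.le]
    · simp [Set.indicator, hx]
  by_cases hF : F = ∞
  · subst hF
    rw [ENNReal.top_rpow_of_pos hb', ENNReal.top_div_of_ne_top ENNReal.ofReal_ne_top]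
    refine ENNReal.eq_top_of_forall_nnreal_le fun r => ?_
    have hd0 : ENNReal.ofReal (b + 1) ≠ 0 := by simpa using hb'
    -- The cutoff below which the power has integral exactly `r`; as `r` is arbitrary, the full
    -- integral diverges.
    set N : ℝ≥0∞ := (r * ENNReal.ofReal (b + 1)) ^ (b + 1)⁻¹ with hN
    have hNt : N ≠ ∞ := ENNReal.rpow_ne_top_of_nonneg (by positivity)
      (ENNReal.mul_ne_top ENNReal.coe_ne_top ENNReal.ofReal_ne_top)
    have := key N.toReal ENNReal.toReal_nonneg
    rw [ENNReal.ofReal_toReal hNt, hN, ENNReal.rpow_inv_rpow hb'.ne',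
      ENNReal.mul_div_cancel_right hd0 ENNReal.ofReal_ne_top] at this
    rw [← this]
    refine lintegral_mono fun x => Set.indicator_le_indicator_of_subset ?_ (fun _ => zero_le) _
    intro x hx
    exact lt_of_lt_of_le (Set.mem_ofPred_eq ▸ hx) le_top
  · have := key F.toReal ENNReal.toReal_nonneg
    rwa [ENNReal.ofReal_toReal hF] at this

/-- Tonelli in `(l, x)`. The weight `H` lets one formula serve both interpolation arguments below:
the maximal theorem and Hausdorff–Young, where superlevel sets are controlled by integrals over
truncation regions. -/
theorem lintegral_rpow_mul_setLIntegral {α : Type*} [MeasurableSpace α] {μ : Measure α} [SFinite μ]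
    {F H : α → ℝ≥0∞} (hF : Measurable F) (hH : Measurable H) {b : ℝ} (hb : -1 < b) :
    ∫⁻ l in Set.Ioi (0 : ℝ), ENNReal.ofReal (l ^ b) *
      ∫⁻ x in {x | ENNReal.ofReal l < F x}, H x ∂μ
      = ∫⁻ x, H x * (F x ^ (b + 1) / ENNReal.ofReal (b + 1)) ∂μ := by
  have hms : MeasurableSet {z : ℝ × α | ENNReal.ofReal z.1 < F z.2} :=
    measurableSet_lt (by fun_prop) (by fun_prop)
  calc _ = ∫⁻ l in Set.Ioi (0 : ℝ), ∫⁻ x, {z : ℝ × α | ENNReal.ofReal z.1 < F z.2}.indicator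
        (fun z => ENNReal.ofReal (z.1 ^ b) * H z.2) (l, x) ∂μ := by
        congr 1 with l
        rw [← lintegral_indicator (measurableSet_lt measurable_const hF),
          ← lintegral_const_mul _ (hH.indicator (measurableSet_lt measurable_const hF))]
        congr 1 with x
        by_cases h : ENNReal.ofReal l < F x <;> simp [Set.indicator, h]
    _ = ∫⁻ x, (∫⁻ l in Set.Ioi (0 : ℝ), {z : ℝ × α | ENNReal.ofReal z.1 < F z.2}.indicator
        (fun z => ENNReal.ofReal (z.1 ^ b) * H z.2) (l, x)) ∂μ := by
        rw [lintegral_lintegral_swap]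
        exact (Measurable.indicator (by fun_prop) hms).aemeasurable
    _ = _ := by
        congr 1 with x
        rw [← lintegral_rpow_of_ofReal_lt hb, ← lintegral_const_mul]
        · congr 1 with l
          by_cases h : ENNReal.ofReal l < F x <;> simp [Set.indicator, h, mul_comm]
        · exact Measurable.indicator (by fun_prop)
            (measurableSet_lt (by fun_prop) measurable_const)

theorem lintegral_rpow_eq_lintegral_superlevel {α : Type*} [MeasurableSpace α] {μ : Measure α}
    [SFinite μ] {F : α → ℝ≥0∞} (hF : Measurable F) {a : ℝ} (ha : 0 < a) :
    ∫⁻ x, F x ^ a ∂μ = ENNReal.ofReal a *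
      ∫⁻ l in Set.Ioi (0 : ℝ), ENNReal.ofReal (l ^ (a - 1)) * μ {x | ENNReal.ofReal l < F x} := by
  have := lintegral_rpow_mul_setLIntegral (μ := μ) hF (H := fun _ => 1) measurable_const
    (b := a - 1) (by linarith)
  simp only [lintegral_one, Measure.restrict_apply MeasurableSet.univ, Set.univ_inter, one_mul,
    sub_add_cancel] at this
  rw [this, ← lintegral_const_mul _ (by fun_prop)]
  congr 1 with x
  rw [ENNReal.mul_div_cancel (by simpa using ha) ENNReal.ofReal_ne_top]

end LayerCake

/-! ### The Hardy–Littlewood maximal theorem. -/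

section Maximal

variable {E : Type*} [NormedAddCommGroup E] [MeasurableSpace E]

/-- The uncentred Hardy–Littlewood maximal function of `u : E → [0, ∞]`. -/
noncomputable def uncentredMaximal (μ : Measure E) (u : E → ℝ≥0∞) (x : E) : ℝ≥0∞ :=
  ⨆ (c : E) (t : ℝ) (_ : x ∈ Metric.ball c t), (∫⁻ y in Metric.ball c t, u y ∂μ) / μ (Metric.ball c t)

theorem lt_uncentredMaximal_iff {μ : Measure E} {u : E → ℝ≥0∞} {x : E} {l : ℝ≥0∞} :
    l < uncentredMaximal μ u x ↔ ∃ c t, x ∈ Metric.ball c t ∧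
      l < (∫⁻ y in Metric.ball c t, u y ∂μ) / μ (Metric.ball c t) := by
  simp [uncentredMaximal, lt_iSup_iff]

/-- The advantage of uncentred balls: a superlevel set is a union of open balls, so measurability
needs no assumption on `u`. -/
theorem isOpen_lt_uncentredMaximal (μ : Measure E) (u : E → ℝ≥0∞) (l : ℝ≥0∞) :
    IsOpen {x | l < uncentredMaximal μ u x} := by
  have : {x | l < uncentredMaximal μ u x} = ⋃ (c : E) (t : ℝ)
      (_ : l < (∫⁻ y in Metric.ball c t, u y ∂μ) / μ (Metric.ball c t)), Metric.ball c t := by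
    ext x
    simp only [Set.mem_ofPred_eq, lt_uncentredMaximal_iff, Set.mem_iUnion, exists_prop]
    constructor <;> rintro ⟨c, t, h1, h2⟩ <;> exact ⟨c, t, h2, h1⟩
  rw [this]
  exact isOpen_iUnion fun c => isOpen_iUnion fun t => isOpen_iUnion fun _ => Metric.isOpen_ball

theorem measurable_uncentredMaximal [BorelSpace E] (μ : Measure E) (u : E → ℝ≥0∞) :
    Measurable (uncentredMaximal μ u) :=
  measurable_of_Ioi fun l => (isOpen_lt_uncentredMaximal μ u l).measurableSet

variable [NormedSpace ℝ E] [FiniteDimensional ℝ E]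

theorem setLIntegral_ball_le_uncentredMaximal (μ : Measure E) [μ.IsAddHaarMeasure] (u : E → ℝ≥0∞)
    {x c : E} {t : ℝ} (hx : x ∈ Metric.ball c t) :
    ∫⁻ y in Metric.ball c t, u y ∂μ ≤ μ (Metric.ball c t) * uncentredMaximal μ u x := by
  have ht : 0 < t := Metric.pos_of_mem_ball hx
  have h0 : μ (Metric.ball c t) ≠ 0 := (Metric.measure_ball_pos μ c ht).ne'
  have h1 : μ (Metric.ball c t) ≠ ∞ := measure_ball_lt_top.ne
  rw [mul_comm, ← ENNReal.div_le_iff h0 h1]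
  exact le_iSup_of_le c (le_iSup_of_le t (le_iSup_of_le hx le_rfl))

/-- The part of `u` below height `l` has all its averages at most `l`. This is the truncation used
to pass from weak type to strong type. -/
theorem uncentredMaximal_le_add [Nontrivial E] (μ : Measure E) [μ.IsAddHaarMeasure]
    (u : E → ℝ≥0∞) (l : ℝ≥0∞) (x : E) :
    uncentredMaximal μ u x ≤ uncentredMaximal μ ({y | l < u y}.indicator u) x + l := by
  refine iSup_le fun c => iSup_le fun t => iSup_le fun hx => ?_
  have ht : 0 < t := Metric.pos_of_mem_ball hx
  have h0 : μ (Metric.ball c t) ≠ 0 := (Metric.measure_ball_pos μ c ht).ne'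
  have h1 : μ (Metric.ball c t) ≠ ∞ := measure_ball_lt_top.ne
  rw [ENNReal.div_le_iff h0 h1]
  calc ∫⁻ y in Metric.ball c t, u y ∂μ
      ≤ ∫⁻ y in Metric.ball c t, ({y | l < u y}.indicator u y + l) ∂μ := by
        refine lintegral_mono fun y => ?_
        by_cases hy : l < u y
        · simp [Set.indicator, hy]
        · simpa [Set.indicator, hy] using not_lt.1 hy
    _ = ∫⁻ y in Metric.ball c t, {y | l < u y}.indicator u y ∂μ + l * μ (Metric.ball c t) := by
        rw [lintegral_add_right _ measurable_const, setLIntegral_const]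
    _ ≤ _ := by
        rw [add_mul, mul_comm (uncentredMaximal _ _ _)]
        gcongr
        exact setLIntegral_ball_le_uncentredMaximal μ _ hx

variable [BorelSpace E]

/-- Vitali covering: among the balls with average above `l`, a disjoint subfamily covers everything
after enlargement by 5, and on disjoint balls the masses of `u` add up to at most the total mass. -/
theorem uncentredMaximal_weak_type [Nontrivial E] (μ : Measure E) [μ.IsAddHaarMeasure]
    (u : E → ℝ≥0∞) {l : ℝ≥0∞} (hl0 : l ≠ 0) (hl : l ≠ ∞) :
    μ {x | l < uncentredMaximal μ u x} ≤
      ENNReal.ofReal (5 ^ Module.finrank ℝ E) * (∫⁻ y, u y ∂μ) / l := by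
  set d := Module.finrank ℝ E
  have hd : d ≠ 0 := Module.finrank_pos.ne'
  have h50 : ENNReal.ofReal (5 ^ d) ≠ 0 := by
    simp
  by_cases hu : ∫⁻ y, u y ∂μ = ∞
  · rw [hu, ENNReal.mul_top h50, ENNReal.top_div_of_ne_top hl]; exact le_top
  set T : Set (E × ℝ) := {p | l < (∫⁻ y in Metric.ball p.1 p.2, u y ∂μ) / μ (Metric.ball p.1 p.2)}
  have hTpos : ∀ p ∈ T, 0 < p.2 := by
    intro p hp
    by_contra hneg
    have : Metric.ball p.1 p.2 = ∅ := Metric.ball_eq_empty.2 (not_lt.1 hneg)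
    have h2 : l < (∫⁻ y in Metric.ball p.1 p.2, u y ∂μ) / μ (Metric.ball p.1 p.2) := hp
    rw [this] at h2
    simp at h2
  have hTball : ∀ p ∈ T, l * μ (Metric.ball p.1 p.2) ≤ ∫⁻ y in Metric.ball p.1 p.2, u y ∂μ := by
    intro p hp
    have h2 : l < (∫⁻ y in Metric.ball p.1 p.2, u y ∂μ) / μ (Metric.ball p.1 p.2) := hp
    exact (ENNReal.le_div_iff_mul_le (Or.inl (Metric.measure_ball_pos μ _ (hTpos p hp)).ne')
      (Or.inl measure_ball_lt_top.ne)).1 h2.le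
  obtain ⟨R, hR⟩ : ∃ R : ℝ, ∀ p ∈ T, p.2 ≤ R := by
    set V : ℝ≥0∞ := (∫⁻ y, u y ∂μ) / l / μ (Metric.ball 0 1)
    have hV : V ≠ ∞ := ENNReal.div_ne_top (ENNReal.div_ne_top hu hl0)
      (Metric.measure_ball_pos μ _ one_pos).ne'
    -- Vitali's lemma needs bounded radii. A selected ball has volume at most `(∫ u) / l`, so its
    -- radius satisfies `p.2 ^ d ≤ V`; a radius above 1 is at most its own `d`-th power.
    refine ⟨max 1 V.toReal, fun p hp => ?_⟩
    by_contra! hlt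
    rw [max_lt_iff] at hlt
    have h1 : ENNReal.ofReal (p.2 ^ d) ≤ V := by
      rw [ENNReal.le_div_iff_mul_le (Or.inl (Metric.measure_ball_pos μ _ one_pos).ne')
        (Or.inl measure_ball_lt_top.ne), ← μ.addHaar_ball_of_pos p.1 (hTpos p hp),
        ENNReal.le_div_iff_mul_le (Or.inl hl0) (Or.inl hl), mul_comm]
      exact (hTball p hp).trans (setLIntegral_le_lintegral _ _)
    rw [← ENNReal.ofReal_toReal hV, ENNReal.ofReal_le_ofReal_iff ENNReal.toReal_nonneg] at h1
    have h2 : p.2 ≤ p.2 ^ d := le_self_pow₀ hlt.1.le hd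
    linarith
  obtain ⟨S, hST, hSd, hSc⟩ := Vitali.exists_disjoint_subfamily_covering_enlargement_ball T
    (fun p => p.1) (fun p => p.2) R hR 5 (by norm_num)
  have hScount : S.Countable := hSd.countable_of_isOpen (fun _ _ => Metric.isOpen_ball)
    fun p hp => Metric.nonempty_ball.2 (hTpos p (hST hp))
  have hcover : {x | l < uncentredMaximal μ u x} ⊆ ⋃ p ∈ S, Metric.ball p.1 (5 * p.2) := by
    intro x hx
    obtain ⟨c, t, hxc, h⟩ := lt_uncentredMaximal_iff.1 hx
    obtain ⟨q, hq, hsub⟩ := hSc (c, t) h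
    exact Set.mem_biUnion hq (hsub hxc)
  rw [ENNReal.le_div_iff_mul_le (Or.inl hl0) (Or.inl hl)]
  calc μ {x | l < uncentredMaximal μ u x} * l
      ≤ (∑' p : S, μ (Metric.ball p.1.1 (5 * p.1.2))) * l := by
        gcongr
        exact (measure_mono hcover).trans (measure_biUnion_le μ hScount _)
    _ = ENNReal.ofReal (5 ^ d) * ∑' p : S, l * μ (Metric.ball p.1.1 p.1.2) := by
        rw [ENNReal.tsum_mul_left, ← mul_assoc, mul_right_comm]
        congr 1
        rw [← ENNReal.tsum_mul_left]
        congr 1 with p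
        rw [μ.addHaar_ball_mul_of_pos _ (by norm_num : (0 : ℝ) < 5), μ.addHaar_ball_center p.1.1]
    _ ≤ ENNReal.ofReal (5 ^ d) * ∑' p : S, ∫⁻ y in Metric.ball p.1.1 p.1.2, u y ∂μ := by
        gcongr with p
        exact hTball p (hST p.2)
    _ = ENNReal.ofReal (5 ^ d) * ∫⁻ y in ⋃ p ∈ S, Metric.ball p.1 p.2, u y ∂μ := by
        rw [lintegral_biUnion hScount (fun _ _ => measurableSet_ball) hSd]
    _ ≤ _ := by gcongr; exact Measure.restrict_le_self

/-- The Hardy–Littlewood maximal theorem. -/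
theorem lintegral_uncentredMaximal_rpow_le [Nontrivial E] (μ : Measure E) [μ.IsAddHaarMeasure]
    {a : ℝ} (ha : 1 < a) : ∃ C : ℝ≥0, ∀ u : E → ℝ≥0∞, Measurable u →
      ∫⁻ x, uncentredMaximal μ u x ^ a ∂μ ≤ C * ∫⁻ x, u x ^ a ∂μ := by
  set D : ℝ≥0∞ := ENNReal.ofReal (5 ^ Module.finrank ℝ E)
  set K : ℝ≥0∞ := ENNReal.ofReal a * (2 * D * (2 ^ (a - 1) / ENNReal.ofReal (a - 1))) with hK
  have hKt : K ≠ ∞ := by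
    refine ENNReal.mul_ne_top ENNReal.ofReal_ne_top (ENNReal.mul_ne_top
      (ENNReal.mul_ne_top (by simp) ENNReal.ofReal_ne_top) (ENNReal.div_ne_top
      (ENNReal.rpow_ne_top_of_nonneg (by linarith) (by simp)) (by simpa using ha)))
  refine ⟨K.toNNReal, fun u hu => ?_⟩
  rw [ENNReal.coe_toNNReal hKt,
    lintegral_rpow_eq_lintegral_superlevel (measurable_uncentredMaximal μ u) (by linarith : 0 < a)]
  -- Truncation at height `l / 2` costs `l / 2` in the maximal function, so the remaining part must
  -- exceed `l / 2`; the weak-type bound is applied to that part.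
  have step : ∀ l ∈ Set.Ioi (0 : ℝ), ENNReal.ofReal (l ^ (a - 1)) *
      μ {x | ENNReal.ofReal l < uncentredMaximal μ u x} ≤
      2 * D * (ENNReal.ofReal (l ^ (a - 2)) *
        ∫⁻ x in {x | ENNReal.ofReal l < 2 * u x}, u x ∂μ) := by
    intro l hl
    have hl : 0 < l := hl
    have hsub : {x | ENNReal.ofReal l < uncentredMaximal μ u x} ⊆
        {x | ENNReal.ofReal (l / 2) <
          uncentredMaximal μ ({y | ENNReal.ofReal (l / 2) < u y}.indicator u) x} := by
      intro x hx
      have h1 := lt_of_lt_of_le hx (uncentredMaximal_le_add μ u (ENNReal.ofReal (l / 2)) x)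
      rw [show ENNReal.ofReal l = ENNReal.ofReal (l / 2) + ENNReal.ofReal (l / 2) by
        rw [← ENNReal.ofReal_add (by positivity) (by positivity)]; congr 1; ring] at h1
      exact lt_of_add_lt_add_right h1
    have hset : {y | ENNReal.ofReal (l / 2) < u y} = {x | ENNReal.ofReal l < 2 * u x} := by
      ext y
      simp only [Set.mem_ofPred_eq]
      rw [ENNReal.ofReal_div_of_pos two_pos, ENNReal.div_lt_iff (by simp) (by simp), mul_comm]
      simp
    have hweak := (measure_mono hsub).trans (uncentredMaximal_weak_type μ
      ({y | ENNReal.ofReal (l / 2) < u y}.indicator u) (l := ENNReal.ofReal (l / 2))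
      (by simpa using hl) ENNReal.ofReal_ne_top)
    rw [lintegral_indicator (measurableSet_lt measurable_const hu), hset] at hweak
    refine (mul_le_mul_right hweak _).trans_eq ?_
    have e1 : (ENNReal.ofReal (l / 2))⁻¹ = 2 * ENNReal.ofReal (l ^ (-1 : ℝ)) := by
      rw [← ENNReal.ofReal_inv_of_pos (by positivity), Real.rpow_neg_one,
        show (2 : ℝ≥0∞) = ENNReal.ofReal 2 by simp, ← ENNReal.ofReal_mul (by norm_num)]
      congr 1; field_simp
    have e2 : ENNReal.ofReal (l ^ (a - 2)) =
        ENNReal.ofReal (l ^ (a - 1)) * ENNReal.ofReal (l ^ (-1 : ℝ)) := by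
      rw [← ENNReal.ofReal_mul (by positivity), ← Real.rpow_add hl]; congr 2; ring
    rw [div_eq_mul_inv, e1, e2]
    ring
  calc _ ≤ ENNReal.ofReal a * ∫⁻ l in Set.Ioi (0 : ℝ), 2 * D * (ENNReal.ofReal (l ^ (a - 2)) *
        ∫⁻ x in {x | ENNReal.ofReal l < 2 * u x}, u x ∂μ) := by
        refine mul_le_mul_right ?_ _
        exact setLIntegral_mono' measurableSet_Ioi step
    _ = _ := by
        rw [lintegral_const_mul' _ _ (ENNReal.mul_ne_top (by simp) ENNReal.ofReal_ne_top),
          lintegral_rpow_mul_setLIntegral (by fun_prop) hu (by linarith), hK,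
          mul_assoc (ENNReal.ofReal a), mul_assoc (2 * D)]
        congr 2
        rw [← lintegral_const_mul _ (by fun_prop)]
        congr 1 with x
        rw [ENNReal.mul_rpow_of_nonneg _ _ (by linarith)]
        have e3 : u x ^ a = u x * u x ^ (a - 1) := by
          conv_lhs => rw [show a = 1 + (a - 1) by ring]
          rw [ENNReal.rpow_add_of_nonneg _ _ (by norm_num) (by linarith), ENNReal.rpow_one]
        rw [e3, show a - 2 + 1 = a - 1 by ring, div_eq_mul_inv, div_eq_mul_inv]
        ring

end Maximal

/-! ### Fractional integration on the line. -/

section RieszPotential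

/-- The Riesz potential of order `1 - α` on the line. -/
noncomputable def rieszPotential (α : ℝ) (v : ℝ → ℝ≥0∞) (x : ℝ) : ℝ≥0∞ :=
  ∫⁻ y, ENNReal.ofReal (|x - y| ^ (-α)) * v y

theorem measurable_rieszPotential (α : ℝ) {v : ℝ → ℝ≥0∞} (hv : Measurable v) :
    Measurable (rieszPotential α v) := by
  unfold rieszPotential
  refine Measurable.lintegral_prod_right' (f := fun z : ℝ × ℝ =>
    ENNReal.ofReal (|z.1 - z.2| ^ (-α)) * v z.2) ?_
  fun_prop

/-- The kernel is written as `α ∫ ρ ^ (-α - 1) dρ` over `ρ > |x - y|`, followed by Tonelli. Only an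
inequality is claimed because `0 ^ (-α) = 0` in `ℝ`, which makes the kernel vanish on the diagonal.
-/
theorem rieszPotential_le_lintegral_ball {α : ℝ} (hα : 0 < α) {v : ℝ → ℝ≥0∞} (hv : Measurable v)
    (x : ℝ) : rieszPotential α v x ≤ ∫⁻ ρ in Set.Ioi (0 : ℝ),
      ENNReal.ofReal (α * ρ ^ (-α - 1)) * ∫⁻ y in Metric.ball x ρ, v y := by
  have hms : MeasurableSet {z : ℝ × ℝ | |x - z.2| < z.1} :=
    measurableSet_lt (by fun_prop) (by fun_prop)
  calc rieszPotential α v x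
      ≤ ∫⁻ y, (∫⁻ ρ in Set.Ioi (0 : ℝ), {z : ℝ × ℝ | |x - z.2| < z.1}.indicator
        (fun z => ENNReal.ofReal (α * z.1 ^ (-α - 1)) * v z.2) (ρ, y)) := by
        refine lintegral_mono fun y => ?_
        rcases (abs_nonneg (x - y)).eq_or_lt' with h | h
        · rw [h, Real.zero_rpow (by linarith)]; simp
        · have := lintegral_Ioi_rpow (b := -α - 1) (by linarith) h
          rw [sub_add_cancel, neg_div_neg_eq, ENNReal.ofReal_div_of_pos hα] at this
          have h2 : ENNReal.ofReal (|x - y| ^ (-α)) = ENNReal.ofReal α *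
              ∫⁻ ρ in Set.Ioi |x - y|, ENNReal.ofReal (ρ ^ (-α - 1)) := by
            rw [this, ENNReal.mul_div_cancel (by simpa using hα) ENNReal.ofReal_ne_top]
          rw [h2, ← lintegral_const_mul _ (by fun_prop), ← lintegral_mul_const _ (by fun_prop),
            ← lintegral_indicator measurableSet_Ioi, ← lintegral_indicator measurableSet_Ioi]
          refine lintegral_mono fun ρ => ?_
          by_cases hρ : |x - y| < ρ
          · have : 0 < ρ := h.trans hρ
            simp [Set.indicator, hρ, this, ENNReal.ofReal_mul hα.le]
          · simp [Set.indicator, hρ]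
    _ = ∫⁻ ρ in Set.Ioi (0 : ℝ), (∫⁻ y, {z : ℝ × ℝ | |x - z.2| < z.1}.indicator
        (fun z => ENNReal.ofReal (α * z.1 ^ (-α - 1)) * v z.2) (ρ, y)) := by
        refine lintegral_lintegral_swap (f := fun y ρ => {z : ℝ × ℝ | |x - z.2| < z.1}.indicator
          (fun z => ENNReal.ofReal (α * z.1 ^ (-α - 1)) * v z.2) (ρ, y)) ?_
        refine Measurable.aemeasurable ?_
        exact (Measurable.indicator (by fun_prop) hms).comp measurable_swap
    _ = _ := by
        congr 1 with ρ
        rw [← lintegral_const_mul _ hv, ← lintegral_indicator Metric.isOpen_ball.measurableSet]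
        congr 1 with y
        simp [Set.indicator, Real.dist_eq, abs_sub_comm]

/-- The radial integral is cut at `R`. On small balls the mass of `v` is at most `2ρ` times the
maximal function; on large balls Hölder bounds it by `(2ρ) ^ (α / 2)` times the norm of `v`. Each
resulting power is integrable on its side of `R`. -/
theorem rieszPotential_le_add {α : ℝ} (hα : 0 < α) (hα1 : α < 1) : ∃ C : ℝ≥0,
    ∀ v : ℝ → ℝ≥0∞, Measurable v → ∀ x R : ℝ, 0 < R → rieszPotential α v x ≤
      C * (ENNReal.ofReal (R ^ (1 - α)) * uncentredMaximal volume v x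
        + ENNReal.ofReal (R ^ (-(α / 2))) * (∫⁻ y, v y ^ (2 / (2 - α))) ^ (1 / (2 / (2 - α)))) := by
  set C₁ : ℝ := 2 * α / (1 - α) with hC₁
  set C₂ : ℝ := 2 * 2 ^ (α / 2) with hC₂
  refine ⟨(max C₁ C₂).toNNReal, fun v hv x R hR => ?_⟩
  set M := uncentredMaximal volume v x
  set N := (∫⁻ y, v y ^ (2 / (2 - α))) ^ (1 / (2 / (2 - α)))
  have hM : ∀ ρ : ℝ, 0 < ρ → ∫⁻ y in Metric.ball x ρ, v y ≤ ENNReal.ofReal (2 * ρ) * M := by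
    intro ρ hρ
    have := setLIntegral_ball_le_uncentredMaximal volume v (Metric.mem_ball_self hρ (x := x))
    rwa [Real.volume_ball] at this
  have hN : ∀ ρ : ℝ, 0 < ρ →
      ∫⁻ y in Metric.ball x ρ, v y ≤ ENNReal.ofReal ((2 * ρ) ^ (α / 2)) * N := by
    intro ρ hρ
    have hc : (2 / (2 - α)).HolderConjugate (2 / α) := by
      refine Real.holderConjugate_iff.2 ⟨?_, ?_⟩
      · rw [lt_div_iff₀ (by linarith)]; linarith
      · have : 2 - α ≠ 0 := by linarith
        field_simp; ring
    have h1 := ENNReal.lintegral_mul_le_Lp_mul_Lq (volume.restrict (Metric.ball x ρ)) hc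
      hv.aemeasurable (g := fun _ => 1) aemeasurable_const
    simp only [Pi.mul_apply, mul_one, ENNReal.one_rpow, lintegral_one, Measure.restrict_apply
      MeasurableSet.univ, Set.univ_inter, Real.volume_ball] at h1
    refine h1.trans ?_
    rw [mul_comm, one_div_div, ENNReal.ofReal_rpow_of_nonneg (by positivity) (by positivity)]
    have : 0 < 2 - α := by linarith
    exact mul_le_mul_right (ENNReal.rpow_le_rpow (setLIntegral_le_lintegral _ _) (by positivity)) _
  refine (rieszPotential_le_lintegral_ball hα hv x).trans ?_
  rw [← Set.Ioo_union_Ici_eq_Ioi hR]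
  refine (lintegral_union_le _ _ _).trans ?_
  rw [setLIntegral_congr (Ioi_ae_eq_Ici (μ := volume) (a := R)).symm, mul_add]
  gcongr
  · calc ∫⁻ ρ in Set.Ioo 0 R, ENNReal.ofReal (α * ρ ^ (-α - 1)) * ∫⁻ y in Metric.ball x ρ, v y
        ≤ ∫⁻ ρ in Set.Ioo 0 R, ENNReal.ofReal (2 * α) * M * ENNReal.ofReal (ρ ^ (-α)) := by
          refine setLIntegral_mono' measurableSet_Ioo fun ρ hρ => ?_
          refine (mul_le_mul_right (hM ρ hρ.1) _).trans_eq ?_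
          rw [mul_right_comm, ← mul_assoc, ← ENNReal.ofReal_mul (mul_nonneg hα.le
            (Real.rpow_nonneg hρ.1.le _)), ← ENNReal.ofReal_mul (by positivity)]
          congr 2
          rw [Real.rpow_sub_one hρ.1.ne']
          have := hρ.1.ne'
          field_simp
      _ = ENNReal.ofReal C₁ * (ENNReal.ofReal (R ^ (1 - α)) * M) := by
          rw [lintegral_const_mul _ (by fun_prop), lintegral_Ioo_rpow (by linarith) hR.le,
            mul_right_comm, ← mul_assoc,
            ← ENNReal.ofReal_mul (by positivity),
            ← ENNReal.ofReal_mul (div_nonneg (by positivity) (by linarith))]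
          congr 2
          rw [show -α + 1 = 1 - α by ring]
          ring
      _ ≤ _ := by gcongr; exact ENNReal.ofReal_le_ofReal (le_max_left _ _)
  · calc ∫⁻ ρ in Set.Ioi R, ENNReal.ofReal (α * ρ ^ (-α - 1)) * ∫⁻ y in Metric.ball x ρ, v y
        ≤ ∫⁻ ρ in Set.Ioi R, ENNReal.ofReal (α * 2 ^ (α / 2)) * N *
            ENNReal.ofReal (ρ ^ (-(α / 2) - 1)) := by
          refine setLIntegral_mono' measurableSet_Ioi fun ρ hρ => ?_
          have hρ0 : 0 < ρ := hR.trans hρ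
          refine (mul_le_mul_right (hN ρ hρ0) _).trans_eq ?_
          rw [mul_right_comm, ← mul_assoc, ← ENNReal.ofReal_mul (mul_nonneg hα.le
            (Real.rpow_nonneg hρ0.le _)), ← ENNReal.ofReal_mul (by positivity)]
          congr 2
          rw [Real.mul_rpow (by norm_num) hρ0.le,
            show -(α / 2) - 1 = (-α - 1) + α / 2 by ring, Real.rpow_add hρ0]
          ring
      _ = ENNReal.ofReal C₂ * (ENNReal.ofReal (R ^ (-(α / 2))) * N) := by
          rw [lintegral_const_mul _ (by fun_prop), lintegral_Ioi_rpow (by linarith) hR,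
            mul_right_comm, ← mul_assoc,
            ← ENNReal.ofReal_mul (by positivity), ← ENNReal.ofReal_mul (by positivity)]
          congr 2
          rw [sub_add_cancel, hC₂]
          field_simp
      _ ≤ _ := by gcongr; exact ENNReal.ofReal_le_ofReal (le_max_right _ _)

/-- Hedberg's inequality. -/
theorem rieszPotential_le_uncentredMaximal_rpow {α : ℝ} (hα : 0 < α) (hα1 : α < 1) : ∃ C : ℝ≥0,
    ∀ v : ℝ → ℝ≥0∞, Measurable v → (∫⁻ y, v y ^ (2 / (2 - α))) ≠ 0 →
      (∫⁻ y, v y ^ (2 / (2 - α))) ≠ ∞ → ∀ x, rieszPotential α v x ≤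
      C * (uncentredMaximal volume v x ^ (α / (2 - α))
        * ((∫⁻ y, v y ^ (2 / (2 - α))) ^ (1 / (2 / (2 - α)))) ^ (1 - α / (2 - α))) := by
  obtain ⟨C, hC⟩ := rieszPotential_le_add hα hα1
  have h2 : 0 < 2 - α := by linarith
  -- The factor 2 adds two equal terms once `R` is optimized. The summand 1 keeps the constant
  -- nonzero, so that the right side is infinite where the maximal function is.
  refine ⟨(C + 1) * 2, fun v hv h0 ht x => ?_⟩
  set M := uncentredMaximal volume v x with hMdef
  set N := (∫⁻ y, v y ^ (2 / (2 - α))) ^ (1 / (2 / (2 - α))) with hN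
  have hN0 : N ≠ 0 := by simp [hN, h0, ht]
  have hNt : N ≠ ∞ := ENNReal.rpow_ne_top_of_nonneg (by positivity) ht
  have hθ : 0 < 1 - α / (2 - α) := by rw [sub_pos, div_lt_one h2]; linarith
  have hM0 : M ≠ 0 := by
    intro hM
    apply h0
    have hz : ∀ n : ℕ, ∫⁻ y in Metric.ball x n, v y = 0 := by
      intro n
      rcases Nat.eq_zero_or_pos n with rfl | hn
      · simp
      · have := setLIntegral_ball_le_uncentredMaximal volume v
          (Metric.mem_ball_self (x := x) (ε := n) (by exact_mod_cast hn))
        rw [← hMdef, hM, mul_zero] at this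
        exact le_antisymm this zero_le
    have hz' : v =ᵐ[volume] 0 := by
      rw [← Measure.restrict_univ (μ := volume), ← Metric.iUnion_ball_nat x, Filter.EventuallyEq,
        ae_restrict_iUnion_iff]
      exact fun n => (lintegral_eq_zero_iff hv).1 (hz n)
    rw [lintegral_eq_zero_iff (by fun_prop)]
    filter_upwards [hz'] with y hy
    simp [hy, h2]
  by_cases hMt : M = ∞
  · rw [hMt, ENNReal.top_rpow_of_pos (by positivity), ENNReal.top_mul, ENNReal.mul_top]
    · exact le_top
    · simp
    · simp [hN0, hNt]
  have hm : 0 < M.toReal := ENNReal.toReal_pos hM0 hMt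
  have hn : 0 < N.toReal := ENNReal.toReal_pos hN0 hNt
  set m := M.toReal with hm'
  set n := N.toReal with hn'
  rw [← ENNReal.ofReal_toReal hMt, ← ENNReal.ofReal_toReal hNt, ← hm', ← hn']
  -- This radius balances the two terms: `R ^ (1 - α) * m = R ^ (-(α / 2)) * n`.
  have hR : 0 < (n / m) ^ (2 / (2 - α)) := by positivity
  refine (hC v hv x _ hR).trans ?_
  rw [← hMdef, ← hN, ← ENNReal.ofReal_toReal hMt, ← ENNReal.ofReal_toReal hNt, ← hm', ← hn',
    ENNReal.ofReal_rpow_of_pos hm, ENNReal.ofReal_rpow_of_pos hn, ← ENNReal.ofReal_mul (by positivity),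
    ← ENNReal.ofReal_mul (by positivity), ← ENNReal.ofReal_mul (by positivity)]
  have e1 : ((n / m) ^ (2 / (2 - α))) ^ (1 - α) * m
      = m ^ (α / (2 - α)) * n ^ (1 - α / (2 - α)) := by
    rw [← Real.rpow_mul (by positivity), show 2 / (2 - α) * (1 - α) = 1 - α / (2 - α) by
      field_simp; ring, Real.div_rpow hn.le hm.le, div_mul_eq_mul_div, div_eq_iff (by positivity)]
    rw [mul_right_comm, ← Real.rpow_add hm]
    simp [mul_comm]
  have e2 : ((n / m) ^ (2 / (2 - α))) ^ (-(α / 2)) * n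
      = m ^ (α / (2 - α)) * n ^ (1 - α / (2 - α)) := by
    rw [← Real.rpow_mul (by positivity), show 2 / (2 - α) * (-(α / 2)) = -(α / (2 - α)) by
      field_simp, Real.rpow_neg (by positivity), Real.div_rpow hn.le hm.le, Real.rpow_sub hn,
      Real.rpow_one]
    field_simp
  rw [e1, e2, ← two_mul, ← mul_assoc]
  push_cast
  gcongr
  exact le_self_add

/-- The Hardy–Littlewood–Sobolev inequality on the line, in bilinear form. -/
theorem lintegral_mul_rieszPotential_le {α : ℝ} (hα : 0 < α) (hα1 : α < 1) : ∃ C : ℝ≥0,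
    ∀ u v : ℝ → ℝ≥0∞, Measurable u → Measurable v →
      ∫⁻ x, u x * rieszPotential α v x ≤ C * ((∫⁻ x, u x ^ (2 / (2 - α))) ^ ((2 - α) / 2) *
        (∫⁻ x, v x ^ (2 / (2 - α))) ^ ((2 - α) / 2)) := by
  obtain ⟨C, hC⟩ := rieszPotential_le_uncentredMaximal_rpow hα hα1
  have h2 : 0 < 2 - α := by linarith
  have ha : 1 < 2 / (2 - α) := by rw [lt_div_iff₀ h2]; linarith
  have hc : (2 / (2 - α)).HolderConjugate (2 / α) := by
    refine Real.holderConjugate_iff.2 ⟨ha, ?_⟩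
    field_simp; ring
  obtain ⟨D, hD⟩ := lintegral_uncentredMaximal_rpow_le (volume : Measure ℝ) ha
  -- The summand 1 keeps the right side infinite when `V = ∞` and `U ≠ 0`.
  refine ⟨C * D ^ (α / 2) + 1, fun u v hu hv => ?_⟩
  set U := ∫⁻ x, u x ^ (2 / (2 - α)) with hU
  set V := ∫⁻ x, v x ^ (2 / (2 - α)) with hV
  have zero_ae : ∀ w : ℝ → ℝ≥0∞, Measurable w → ∫⁻ x, w x ^ (2 / (2 - α)) = 0 → w =ᵐ[volume] 0 := by
    intro w hw h
    rw [lintegral_eq_zero_iff (by fun_prop)] at h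
    filter_upwards [h] with x hx
    simpa [h2, h2.le, not_lt.2 (zero_le_one.trans ha.le)] using hx
  by_cases hU0 : U = 0
  · have : ∫⁻ x, u x * rieszPotential α v x = 0 := by
      refine (lintegral_eq_zero_iff (hu.mul (measurable_rieszPotential α hv))).2 ?_
      filter_upwards [zero_ae u hu hU0] with x hx
      simp [hx]
    rw [this]; exact zero_le
  by_cases hV0 : V = 0
  · have : ∀ x, rieszPotential α v x = 0 := by
      intro x
      unfold rieszPotential
      rw [lintegral_eq_zero_iff (by fun_prop)]
      filter_upwards [zero_ae v hv hV0] with x hx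
      simp [hx]
    simp [this]
  by_cases hVt : V = ∞
  · rw [hVt, ENNReal.top_rpow_of_pos (by positivity), ENNReal.mul_top, ENNReal.mul_top]
    · exact le_top
    · simp
    · simp [hU0, (half_pos h2).le]
  have hVr : V ^ (1 / (2 / (2 - α))) = V ^ ((2 - α) / 2) := by rw [one_div_div]
  -- Raising Hedberg's bound to the power `2 / α` turns the exponent `α / (2 - α)` of the maximal
  -- function into `2 / (2 - α)`, where the maximal theorem applies.
  have key : (∫⁻ x, rieszPotential α v x ^ (2 / α)) ^ (1 / (2 / α))
      ≤ (C * D ^ (α / 2) : ℝ≥0) * V ^ ((2 - α) / 2) := by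
    calc (∫⁻ x, rieszPotential α v x ^ (2 / α)) ^ (1 / (2 / α))
        ≤ (∫⁻ x, (C * (uncentredMaximal volume v x ^ (α / (2 - α))
          * (V ^ ((2 - α) / 2)) ^ (1 - α / (2 - α)))) ^ (2 / α)) ^ (1 / (2 / α)) := by
          gcongr with x
          rw [← hVr]
          exact hC v hv hV0 hVt x
      _ = ((C * (V ^ ((2 - α) / 2)) ^ (1 - α / (2 - α))) ^ (2 / α) *
          ∫⁻ x, uncentredMaximal volume v x ^ (2 / (2 - α))) ^ (1 / (2 / α)) := by
          rw [← lintegral_const_mul _ ((measurable_uncentredMaximal _ _).pow_const _)]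
          congr 2 with x
          rw [mul_left_comm, mul_comm (_ ^ (α / (2 - α))), ENNReal.mul_rpow_of_nonneg _ _
            (by positivity), ← ENNReal.rpow_mul (uncentredMaximal volume v x),
            show α / (2 - α) * (2 / α) = 2 / (2 - α) by field_simp]
      _ ≤ ((C * (V ^ ((2 - α) / 2)) ^ (1 - α / (2 - α))) ^ (2 / α) * (D * V)) ^ (1 / (2 / α)) := by
          gcongr
          exact hD v hv
      _ = _ := by
          rw [ENNReal.mul_rpow_of_nonneg _ _ (by positivity), ← ENNReal.rpow_mul,
            mul_one_div_cancel (by positivity), ENNReal.rpow_one, one_div_div,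
            ENNReal.mul_rpow_of_nonneg _ _ (by positivity), ENNReal.coe_mul,
            ENNReal.coe_rpow_of_nonneg _ (by positivity), mul_assoc, mul_assoc,
            mul_left_comm (_ ^ _) ((D : ℝ≥0∞) ^ _), ← ENNReal.rpow_mul,
            ← ENNReal.rpow_add _ _ hV0 hVt]
          congr 3
          field_simp
          ring
  calc ∫⁻ x, u x * rieszPotential α v x
      ≤ U ^ (1 / (2 / (2 - α))) * (∫⁻ x, rieszPotential α v x ^ (2 / α)) ^ (1 / (2 / α)) :=
        ENNReal.lintegral_mul_le_Lp_mul_Lq volume hc hu.aemeasurable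
          (measurable_rieszPotential α hv).aemeasurable
    _ ≤ U ^ ((2 - α) / 2) * ((C * D ^ (α / 2) : ℝ≥0) * V ^ ((2 - α) / 2)) := by
        rw [one_div_div]; gcongr
    _ ≤ _ := by
        rw [mul_left_comm]
        gcongr
        exact le_self_add

end RieszPotential

/-! ### Sums of two points of the circle, and fractional integration in the angle. -/

section ChangeOfVariables

open Real

/-- The unit speed parametrization of the unit circle. -/
noncomputable def circlePoint (θ : ℝ) : Plane := !₂[cos θ, sin θ]

theorem measurable_circlePoint : Measurable circlePoint := by
  unfold circlePoint
  exact (by fun_prop : Continuous fun θ : ℝ => (!₂[cos θ, sin θ] : Plane)).measurable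

/-- Let S be the common sum. If P and S - P are unit vectors, then P·S = |S|²/2, so all four points
have the same component along S (`d1`, `d2`). Their components across S then agree up to sign, and
the two summands of a pair carry opposite signs (`c`). -/
theorem eq_or_eq_of_add_eq_add_of_sq_add_sq {x₁ x₂ x₃ x₄ y₁ y₂ y₃ y₄ : ℝ}
    (h₁ : x₁ ^ 2 + y₁ ^ 2 = 1) (h₂ : x₂ ^ 2 + y₂ ^ 2 = 1) (h₃ : x₃ ^ 2 + y₃ ^ 2 = 1)
    (h₄ : x₄ ^ 2 + y₄ ^ 2 = 1) (hx : x₁ + x₂ = x₃ + x₄) (hy : y₁ + y₂ = y₃ + y₄)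
    (hne : (x₁ + x₂) ^ 2 + (y₁ + y₂) ^ 2 ≠ 0) : (x₃ = x₁ ∧ y₃ = y₁) ∨ (x₃ = x₂ ∧ y₃ = y₂) := by
  obtain rfl : x₄ = x₁ + x₂ - x₃ := by linarith
  obtain rfl : y₄ = y₁ + y₂ - y₃ := by linarith
  set X := x₁ + x₂ with hX
  set Y := y₁ + y₂ with hY
  have key : ∀ x y : ℝ, (x - x₃) * X + (y - y₃) * Y = 0 → (x - x₃) * Y - (y - y₃) * X = 0 →
      x₃ = x ∧ y₃ = y := by
    intro x y ha hb
    have e1 : (x - x₃) * (X ^ 2 + Y ^ 2) = 0 := by linear_combination X * ha + Y * hb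
    have e2 : (y - y₃) * (X ^ 2 + Y ^ 2) = 0 := by linear_combination Y * ha - X * hb
    have f1 := (mul_eq_zero.1 e1).resolve_right hne
    have f2 := (mul_eq_zero.1 e2).resolve_right hne
    constructor <;> linarith
  have d1 : (x₁ - x₃) * X + (y₁ - y₃) * Y = 0 := by
    have := h₂
    rw [show x₂ = X - x₁ by linarith, show y₂ = Y - y₁ by linarith] at this
    linear_combination (1 / 2 : ℝ) * (h₄ - this) + (1 / 2 : ℝ) * (h₁ - h₃)
  have d2 : (x₂ - x₃) * X + (y₂ - y₃) * Y = 0 := by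
    have := h₁
    rw [show x₁ = X - x₂ by linarith, show y₁ = Y - y₂ by linarith] at this
    linear_combination (1 / 2 : ℝ) * (h₄ - this) + (1 / 2 : ℝ) * (h₂ - h₃)
  have c : ((x₁ - x₃) * Y - (y₁ - y₃) * X) * ((x₂ - x₃) * Y - (y₂ - y₃) * X) = 0 := by
    have hx2 : x₂ = X - x₁ := by linarith
    have hy2 : y₂ = Y - y₁ := by linarith
    have i1 : (x₁ * Y - y₁ * X) ^ 2 + (x₁ * X + y₁ * Y) ^ 2 = X ^ 2 + Y ^ 2 := by
      linear_combination (X ^ 2 + Y ^ 2) * h₁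
    have i3 : (x₃ * Y - y₃ * X) ^ 2 + (x₃ * X + y₃ * Y) ^ 2 = X ^ 2 + Y ^ 2 := by
      linear_combination (X ^ 2 + Y ^ 2) * h₃
    rw [hx2, hy2]
    linear_combination i3 - i1 + (x₁ * X + y₁ * Y + x₃ * X + y₃ * Y) * d1
  rcases mul_eq_zero.1 c with c | c
  · exact Or.inl (key _ _ d1 c)
  · exact Or.inr (key _ _ d2 c)

theorem eq_of_cos_eq_of_sin_eq {a b : ℝ} (ha : a ∈ Set.Ioc 0 (2 * π)) (hb : b ∈ Set.Ioc 0 (2 * π))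
    (hc : cos a = cos b) (hs : sin a = sin b) : a = b := by
  obtain ⟨k, hk⟩ := Real.Angle.angle_eq_iff_two_pi_dvd_sub.1 (Real.Angle.cos_sin_inj hc hs)
  have hpi := Real.pi_pos
  have h1 : (k : ℝ) < 1 := by
    by_contra! h
    nlinarith [ha.1, ha.2, hb.1, hb.2]
  have h2 : (-1 : ℝ) < k := by
    by_contra! h
    nlinarith [ha.1, ha.2, hb.1, hb.2]
  have : k = 0 := by
    have h1' : k < 1 := by exact_mod_cast h1
    have h2' : -1 < k := by exact_mod_cast h2
    omega
  subst this
  simp at hk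
  linarith

/-- The sum map `(θ, θ') ↦ e^{iθ} + e^{iθ'}`. -/
noncomputable def circleSum (z : ℝ × ℝ) : ℝ × ℝ := (cos z.1 + cos z.2, sin z.1 + sin z.2)

/-- The condition on the sine excludes antipodal pairs, whose sum is zero and does not determine
them. -/
theorem circleSum_eq {a b c d : ℝ} (ha : a ∈ Set.Ioc 0 (2 * π)) (hb : b ∈ Set.Ioc 0 (2 * π))
    (hc : c ∈ Set.Ioc 0 (2 * π)) (hd : d ∈ Set.Ioc 0 (2 * π)) (hs : sin (a - b) ≠ 0)
    (h : circleSum (a, b) = circleSum (c, d)) : (a = c ∧ b = d) ∨ (b = c ∧ a = d) := by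
  simp only [circleSum, Prod.mk.injEq] at h
  obtain ⟨hx, hy⟩ := h
  have hne : (cos a + cos b) ^ 2 + (sin a + sin b) ^ 2 ≠ 0 := by
    intro h0
    apply hs
    have h1 : cos a + cos b = 0 := by nlinarith [sq_nonneg (cos a + cos b), sq_nonneg (sin a + sin b)]
    have h2 : sin a + sin b = 0 := by nlinarith [sq_nonneg (cos a + cos b), sq_nonneg (sin a + sin b)]
    rw [sin_sub]
    linear_combination sin a * h1 - cos a * h2
  rcases eq_or_eq_of_add_eq_add_of_sq_add_sq (cos_sq_add_sin_sq a) (cos_sq_add_sin_sq b)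
    (cos_sq_add_sin_sq c) (cos_sq_add_sin_sq d) hx hy hne with ⟨h1, h2⟩ | ⟨h1, h2⟩
  · exact Or.inl ⟨eq_of_cos_eq_of_sin_eq ha hc h1.symm h2.symm,
      eq_of_cos_eq_of_sin_eq hb hd (by linarith) (by linarith)⟩
  · exact Or.inr ⟨eq_of_cos_eq_of_sin_eq hb hc h1.symm h2.symm,
      eq_of_cos_eq_of_sin_eq ha hd (by linarith) (by linarith)⟩

/-- The derivative of `circleSum`. -/
noncomputable def fderivCircleSum (z : ℝ × ℝ) : ℝ × ℝ →L[ℝ] ℝ × ℝ :=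
  LinearMap.toContinuousLinearMap (Matrix.toLin (Module.Basis.finTwoProd ℝ)
    (Module.Basis.finTwoProd ℝ) !![-sin z.1, -sin z.2; cos z.1, cos z.2])

theorem det_fderivCircleSum (z : ℝ × ℝ) : (fderivCircleSum z).det = sin (z.2 - z.1) := by
  rw [fderivCircleSum, ContinuousLinearMap.det, LinearMap.coe_toContinuousLinearMap,
    LinearMap.det_toLin, Matrix.det_fin_two_of, sin_sub]
  ring

theorem hasFDerivAt_circleSum (z : ℝ × ℝ) : HasFDerivAt circleSum (fderivCircleSum z) z := by
  unfold fderivCircleSum circleSum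
  rw [Matrix.toLin_finTwoProd_toContinuousLinearMap]
  convert! HasFDerivAt.prodMk (𝕜 := ℝ)
    (((hasDerivAt_cos z.1).comp_hasFDerivAt z hasFDerivAt_fst).add
      ((hasDerivAt_cos z.2).comp_hasFDerivAt z hasFDerivAt_snd))
    (((hasDerivAt_sin z.1).comp_hasFDerivAt z hasFDerivAt_fst).add
      ((hasDerivAt_sin z.2).comp_hasFDerivAt z hasFDerivAt_snd)) using 2

/-- The Jacobian is `sin (z.2 - z.1)`. A sum determines the unordered pair, so the map is injective
on each of the halves `z.1 < z.2` and `z.2 < z.1` off the zeros of the sine; hence the factor 2. On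
those zeros the integrand vanishes. -/
theorem setLIntegral_circleSum_le (H : ℝ × ℝ → ℝ≥0∞) :
    ∫⁻ z in Set.Ioc 0 (2 * π) ×ˢ Set.Ioc 0 (2 * π),
      ENNReal.ofReal |sin (z.1 - z.2)| * H (circleSum z) ≤ 2 * ∫⁻ w, H w := by
  set Q : Set (ℝ × ℝ) := Set.Ioc 0 (2 * π) ×ˢ Set.Ioc 0 (2 * π) with hQ
  have hQm : MeasurableSet Q := measurableSet_Ioc.prod measurableSet_Ioc
  have hN : MeasurableSet {z : ℝ × ℝ | sin (z.1 - z.2) ≠ 0} :=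
    measurableSet_eq_fun (by fun_prop) (by fun_prop) |>.compl
  have key : ∀ T : Set (ℝ × ℝ), MeasurableSet T → (∀ a b, (a, b) ∈ T → (b, a) ∉ T) →
      ∫⁻ z in Q ∩ {z | sin (z.1 - z.2) ≠ 0} ∩ T,
        ENNReal.ofReal |sin (z.1 - z.2)| * H (circleSum z) ≤ ∫⁻ w, H w := by
    intro T hT hasym
    have hinj : Set.InjOn circleSum (Q ∩ {z | sin (z.1 - z.2) ≠ 0} ∩ T) := by
      rintro ⟨a, b⟩ ⟨⟨⟨ha, hb⟩, hs⟩, hT1⟩ ⟨c, d⟩ ⟨⟨⟨hc, hd⟩, -⟩, hT2⟩ h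
      rcases circleSum_eq ha hb hc hd hs h with ⟨rfl, rfl⟩ | ⟨h1, h2⟩
      · rfl
      · dsimp only at h1 h2
        subst h1 h2
        exact absurd hT2 (hasym _ _ hT1)
    have := lintegral_image_eq_lintegral_abs_det_fderiv_mul volume ((hQm.inter hN).inter hT)
      (fun z _ => (hasFDerivAt_circleSum z).hasFDerivWithinAt) hinj H
    calc _ = _ := by
          rw [this]
          congr 1 with z
          rw [det_fderivCircleSum, ← abs_neg, ← sin_neg, neg_sub]
      _ ≤ _ := setLIntegral_le_lintegral _ _
  have h1 := key {z | z.1 < z.2} (measurableSet_lt measurable_fst measurable_snd)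
    (fun a b h h' => lt_asymm (α := ℝ) h h')
  have h2 := key {z | z.2 < z.1} (measurableSet_lt measurable_snd measurable_fst)
    (fun a b h h' => lt_asymm (α := ℝ) h h')
  rw [two_mul]
  refine le_trans ?_ (add_le_add h1 h2)
  refine le_trans ?_ (lintegral_union_le _ _ _)
  rw [← lintegral_indicator hQm, ← lintegral_indicator]
  · refine lintegral_mono fun z => ?_
    by_cases hz : z ∈ Q
    · by_cases hs : sin (z.1 - z.2) = 0
      · simp [hs]
      · have : z.1 ≠ z.2 := by rintro h; simp [h] at hs
        rw [Set.indicator_of_mem hz, Set.indicator_of_mem]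
        rcases this.lt_or_gt with h | h
        · exact Or.inl ⟨⟨hz, hs⟩, h⟩
        · exact Or.inr ⟨⟨hz, hs⟩, h⟩
    · simp [hz]
  · exact ((hQm.inter hN).inter (measurableSet_lt measurable_fst measurable_snd)).union
      ((hQm.inter hN).inter (measurableSet_lt measurable_snd measurable_fst))

/-- Sums of two points of the unit circle, weighted by the Jacobian, cover the plane at most
twice. -/
theorem setLIntegral_circlePoint_add_le (H : Plane → ℝ≥0∞) :
    ∫⁻ z in Set.Ioc 0 (2 * π) ×ˢ Set.Ioc 0 (2 * π),
      ENNReal.ofReal |sin (z.1 - z.2)| * H (circlePoint z.1 + circlePoint z.2) ≤ 2 * ∫⁻ w, H w := by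
  have hmp : MeasurePreserving (fun w : ℝ × ℝ => (!₂[w.1, w.2] : Plane)) := by
    have := (PiLp.volume_preserving_toLp (Fin 2)).comp (volume_preserving_finTwoArrow ℝ).symm
    convert! this using 2
  have hemb : MeasurableEmbedding (fun w : ℝ × ℝ => (!₂[w.1, w.2] : Plane)) := by
    have := (MeasurableEquiv.toLp 2 (Fin 2 → ℝ)).measurableEmbedding.comp
      (MeasurableEquiv.finTwoArrow (α := ℝ)).symm.measurableEmbedding
    convert! this using 2
  have h := setLIntegral_circleSum_le fun w => H !₂[w.1, w.2]
  rw [hmp.lintegral_comp_emb hemb] at h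
  convert! h using 5 with z
  ext i
  fin_cases i <;> simp [circlePoint, circleSum]

/-- `|sin φ|` dominates the distance to the zeros of `sin` for `|φ| ≤ 2π`. -/
theorem abs_sin_rpow_neg_le {α : ℝ} (hα : 0 < α) {φ : ℝ} (hφ : |φ| ≤ 2 * π) :
    |sin φ| ^ (-α) ≤ (2 / π) ^ (-α) * ∑ k ∈ Finset.Icc (-2 : ℤ) 2, |φ - k * π| ^ (-α) := by
  have hpi := Real.pi_pos
  -- `k * π` is the nearest zero of the sine, at distance at most `π / 2`, where Jordan's inequality
  -- holds. The range of `φ` forces `|k| ≤ 2`.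
  set k : ℤ := round (φ / π) with hk
  have habs : |φ - k * π| ≤ π / 2 := by
    have h1 := abs_sub_round (φ / π)
    rw [← hk] at h1
    have h2 : φ - k * π = (φ / π - k) * π := by field_simp
    rw [h2, abs_mul, abs_of_pos hpi]
    nlinarith
  have hkm : k ∈ Finset.Icc (-2 : ℤ) 2 := by
    rw [abs_le] at habs hφ
    rw [Finset.mem_Icc]
    constructor
    · by_contra! h
      have : (k : ℝ) ≤ -3 := by exact_mod_cast (by omega : k ≤ -3)
      nlinarith
    · by_contra! h
      have : (3 : ℝ) ≤ k := by exact_mod_cast (by omega : 3 ≤ k)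
      nlinarith
  have hsin : |sin φ| = |sin (φ - k * π)| := by
    rw [sin_sub_int_mul_pi, abs_mul]
    simp
  have hlow : 2 / π * |φ - k * π| ≤ |sin φ| := by
    rw [hsin]
    exact mul_abs_le_abs_sin habs
  have hnn : ∀ j ∈ Finset.Icc (-2 : ℤ) 2, 0 ≤ |φ - j * π| ^ (-α) := fun j _ => by positivity
  rcases (abs_nonneg (φ - k * π)).eq_or_lt' with h0 | h0
  · have : |sin φ| = 0 := by rw [hsin, abs_eq_zero.1 h0]; simp
    rw [this, zero_rpow (by linarith)]
    exact mul_nonneg (by positivity) (Finset.sum_nonneg hnn)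
  · calc |sin φ| ^ (-α) ≤ (2 / π * |φ - k * π|) ^ (-α) :=
          rpow_le_rpow_of_nonpos (by positivity) hlow (by linarith)
      _ = (2 / π) ^ (-α) * |φ - k * π| ^ (-α) := mul_rpow (by positivity) (by positivity)
      _ ≤ _ := by
          gcongr
          exact Finset.single_le_sum hnn hkm

/-- Fractional integration on the circle. -/
theorem setLIntegral_abs_sin_rpow_le {α : ℝ} (hα : 0 < α) (hα1 : α < 1) : ∃ C : ℝ≥0,
    ∀ u : ℝ → ℝ≥0∞, Measurable u →
      ∫⁻ z in Set.Ioc 0 (2 * π) ×ˢ Set.Ioc 0 (2 * π),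
        ENNReal.ofReal (|sin (z.1 - z.2)| ^ (-α)) * (u z.1 * u z.2) ≤
      C * (∫⁻ x in Set.Ioc 0 (2 * π), u x ^ (2 / (2 - α))) ^ (2 - α) := by
  obtain ⟨C, hC⟩ := lintegral_mul_rieszPotential_le hα hα1
  have h2 : 0 < 2 - α := by linarith
  have ha : 0 < 2 / (2 - α) := by positivity
  refine ⟨((2 / π) ^ (-α)).toNNReal * (5 * C), fun u hu => ?_⟩
  set I : Set ℝ := Set.Ioc 0 (2 * π) with hI
  have hIm : MeasurableSet I := measurableSet_Ioc
  set U := ∫⁻ x in I, u x ^ (2 / (2 - α)) with hU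
  set v := I.indicator u with hv
  have hvm : Measurable v := hu.indicator hIm
  have hvU : ∫⁻ x, v x ^ (2 / (2 - α)) = U := by
    rw [hU, ← lintegral_indicator hIm]
    congr 1 with x
    by_cases hx : x ∈ I <;> simp [hv, hx, ha]
  -- The singularity at `k * π` becomes the one at the origin after translating one factor. Norms
  -- are unaffected, so the five zeros cost only the factor 5.
  have hshift : ∀ c : ℝ, ∫⁻ x, v x * rieszPotential α (fun y => v (y - c)) x ≤ C * U ^ (2 - α) := by
    intro c
    refine (hC v _ hvm (hvm.comp (measurable_sub_const c))).trans_eq ?_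
    simp only [Function.comp_apply]
    rw [lintegral_sub_right_eq_self (fun y => v y ^ (2 / (2 - α))) c, hvU,
      ← ENNReal.rpow_add_of_nonneg _ _ (by positivity) (by positivity)]
    congr 2
    ring
  have hterm : ∀ k : ℤ, ∫⁻ z : ℝ × ℝ, ENNReal.ofReal (|z.1 - z.2 - k * π| ^ (-α)) *
      (v z.1 * v z.2) ≤ C * U ^ (2 - α) := by
    intro k
    refine le_trans (le_of_eq ?_) (hshift (k * π))
    rw [Measure.volume_eq_prod, lintegral_prod _ (by fun_prop)]
    congr 1 with x
    rw [rieszPotential, ← lintegral_const_mul _ (by fun_prop), ← lintegral_add_right_eq_self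
      (fun y => v x * (ENNReal.ofReal (|x - y| ^ (-α)) * v (y - k * π))) (k * π)]
    congr 1 with y
    simp only [add_sub_cancel_right, sub_sub]
    ring
  calc ∫⁻ z in I ×ˢ I, ENNReal.ofReal (|sin (z.1 - z.2)| ^ (-α)) * (u z.1 * u z.2)
      ≤ ∫⁻ z : ℝ × ℝ, ENNReal.ofReal ((2 / π) ^ (-α)) * ∑ k ∈ Finset.Icc (-2 : ℤ) 2,
        ENNReal.ofReal (|z.1 - z.2 - k * π| ^ (-α)) * (v z.1 * v z.2) := by
        rw [← lintegral_indicator (hIm.prod hIm)]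
        refine lintegral_mono fun z => ?_
        by_cases hz : z ∈ I ×ˢ I
        · have hz' : |z.1 - z.2| ≤ 2 * π := by
            rw [abs_le]; constructor <;> linarith [hz.1.1, hz.1.2, hz.2.1, hz.2.2]
          rw [Set.indicator_of_mem hz, ← Finset.sum_mul,
            ← mul_assoc (ENNReal.ofReal ((2 / π) ^ (-α))),
            ← ENNReal.ofReal_sum_of_nonneg (fun k _ => by positivity),
            ← ENNReal.ofReal_mul (by positivity)]
          simp only [hv, Set.indicator_of_mem hz.1, Set.indicator_of_mem hz.2]
          gcongr
          exact abs_sin_rpow_neg_le hα hz'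
        · rw [Set.indicator_of_notMem hz]; exact zero_le
    _ ≤ ENNReal.ofReal ((2 / π) ^ (-α)) * ∑ k ∈ Finset.Icc (-2 : ℤ) 2, C * U ^ (2 - α) := by
        rw [lintegral_const_mul' _ _ ENNReal.ofReal_ne_top,
          lintegral_finsetSum' _ (fun k _ => by fun_prop)]
        gcongr with k
        exact hterm k
    _ = _ := by
        rw [Finset.sum_const, Int.card_Icc]
        simp [ENNReal.ofReal, mul_assoc]

end ChangeOfVariables

/-! ### Superpositions of kernels near the circle and their self-convolution. -/

section Extension

open Real

/-- A kernel normalized in `L²` on a ball has mass at most one. -/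
theorem lintegral_le_one_of_lintegral_sq_le {c : Plane} {t : ℝ} (ht : 0 < t) {κ : Plane → ℝ≥0∞}
    (hκ : Measurable κ) (hs : ∀ y ∉ Metric.ball c t, κ y = 0)
    (hn : ∫⁻ y, κ y ^ (2 : ℝ) ≤ (volume (Metric.ball c t))⁻¹) : ∫⁻ y, κ y ≤ 1 := by
  have hrestrict : ∫⁻ y, κ y = ∫⁻ y in Metric.ball c t, κ y * 1 := by
    rw [← lintegral_indicator measurableSet_ball]
    congr 1 with y
    by_cases hy : y ∈ Metric.ball c t
    · rw [Set.indicator_of_mem hy, mul_one]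
    · rw [Set.indicator_of_notMem hy, hs y hy]
  rw [hrestrict]
  refine (ENNReal.lintegral_mul_le_Lp_mul_Lq _ Real.HolderConjugate.two_two
    hκ.aemeasurable aemeasurable_const).trans ?_
  simp only [ENNReal.one_rpow, lintegral_one, Measure.restrict_apply MeasurableSet.univ,
    Set.univ_inter]
  rw [← ENNReal.mul_rpow_of_nonneg _ _ (by norm_num)]
  refine (ENNReal.rpow_le_rpow (mul_le_mul_left ((setLIntegral_le_lintegral _ _).trans hn) _)
    (by norm_num)).trans ?_
  rw [ENNReal.inv_mul_cancel (Metric.measure_ball_pos volume c ht).ne' measure_ball_lt_top.ne,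
    ENNReal.one_rpow]

/-- A pair of kernels normalized in `L²` on balls tests `h` no better than its quadratic maximal
function at the sum of the centres. -/
theorem lintegral_lintegral_mul_le_uncentredMaximal {c₁ c₂ : Plane} {t₁ t₂ : ℝ} (ht₂ : 0 < t₂)
    (h12 : t₂ ≤ t₁) {κ₁ κ₂ h : Plane → ℝ≥0∞} (hκ₁ : Measurable κ₁) (hκ₂ : Measurable κ₂)
    (hh : Measurable h) (hs₁ : ∀ y ∉ Metric.ball c₁ t₁, κ₁ y = 0)
    (hs₂ : ∀ y ∉ Metric.ball c₂ t₂, κ₂ y = 0)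
    (hn₁ : ∫⁻ y, κ₁ y ^ (2 : ℝ) ≤ (volume (Metric.ball c₁ t₁))⁻¹)
    (hn₂ : ∫⁻ y, κ₂ y ^ (2 : ℝ) ≤ (volume (Metric.ball c₂ t₂))⁻¹) :
    ∫⁻ w, ∫⁻ y, h (y + w) * (κ₁ y * κ₂ w) ≤
      2 * uncentredMaximal volume (fun y => h y ^ (2 : ℝ)) (c₁ + c₂) ^ (1 / 2 : ℝ) := by
  have ht₁ : 0 < t₁ := ht₂.trans_le h12
  set M := uncentredMaximal volume (fun y => h y ^ (2 : ℝ)) (c₁ + c₂)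
  have hv0 : ∀ (c : Plane) (t : ℝ), 0 < t → volume (Metric.ball c t) ≠ 0 :=
    fun c t ht => (Metric.measure_ball_pos volume c ht).ne'
  have hvt : ∀ (c : Plane) (t : ℝ), volume (Metric.ball c t) ≠ ∞ :=
    fun c t => measure_ball_lt_top.ne
  -- Translating by `w`, which lies within `t₂ ≤ t₁` of `c₂`, sends the larger ball into the ball of
  -- radius `2 * t₁` about `c₁ + c₂`. Its area is four times that of the larger ball; Cauchy–Schwarz
  -- turns the 4 into a 2.
  have inner_le : ∀ w ∈ Metric.ball c₂ t₂, ∫⁻ y, h (y + w) * κ₁ y ≤ 2 * M ^ (1 / 2 : ℝ) := by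
    intro w hw
    set B := volume (Metric.ball c₁ t₁) with hB
    have hshift : ∫⁻ y in Metric.ball c₁ t₁, h (y + w) ^ (2 : ℝ) ≤ 4 * B * M := by
      calc ∫⁻ y in Metric.ball c₁ t₁, h (y + w) ^ (2 : ℝ)
          ≤ ∫⁻ y, (Metric.ball (c₁ + c₂) (2 * t₁)).indicator (fun z => h z ^ (2 : ℝ)) (y + w) := by
            rw [← lintegral_indicator measurableSet_ball]
            refine lintegral_mono fun y => ?_
            by_cases hy : y ∈ Metric.ball c₁ t₁
            · have : y + w ∈ Metric.ball (c₁ + c₂) (2 * t₁) := by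
                rw [Metric.mem_ball] at hy hw ⊢
                calc dist (y + w) (c₁ + c₂) ≤ dist y c₁ + dist w c₂ := dist_add_add_le _ _ _ _
                  _ < t₁ + t₂ := add_lt_add hy hw
                  _ ≤ 2 * t₁ := by linarith
              rw [Set.indicator_of_mem hy, Set.indicator_of_mem this]
            · rw [Set.indicator_of_notMem hy]; exact zero_le
        _ = ∫⁻ z in Metric.ball (c₁ + c₂) (2 * t₁), h z ^ (2 : ℝ) := by
            rw [lintegral_add_right_eq_self
              ((Metric.ball (c₁ + c₂) (2 * t₁)).indicator (fun z => h z ^ (2 : ℝ))) w,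
              lintegral_indicator measurableSet_ball]
        _ ≤ volume (Metric.ball (c₁ + c₂) (2 * t₁)) * M :=
            setLIntegral_ball_le_uncentredMaximal volume _
              (Metric.mem_ball_self (by positivity))
        _ = _ := by
            rw [Measure.addHaar_ball_mul_of_pos volume _ two_pos, hB,
              ← Measure.addHaar_ball_center volume c₁]
            simp only [finrank_euclideanSpace_fin]
            norm_num
    have hrestrict : ∫⁻ y, h (y + w) * κ₁ y
        = ∫⁻ y in Metric.ball c₁ t₁, h (y + w) * κ₁ y := by
      rw [← lintegral_indicator measurableSet_ball]
      congr 1 with y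
      by_cases hy : y ∈ Metric.ball c₁ t₁
      · rw [Set.indicator_of_mem hy]
      · rw [Set.indicator_of_notMem hy, hs₁ y hy, mul_zero]
    rw [hrestrict]
    refine (ENNReal.lintegral_mul_le_Lp_mul_Lq _ Real.HolderConjugate.two_two
      (hh.comp (measurable_add_const w)).aemeasurable hκ₁.aemeasurable).trans ?_
    calc _ ≤ (4 * B * M) ^ (1 / 2 : ℝ) * (B⁻¹) ^ (1 / 2 : ℝ) := by
          gcongr
          · exact hshift
          · exact (setLIntegral_le_lintegral _ _).trans hn₁
      _ = (4 * M) ^ (1 / 2 : ℝ) := by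
          rw [← ENNReal.mul_rpow_of_nonneg _ _ (by norm_num), mul_right_comm 4 B M,
            mul_assoc, ENNReal.mul_inv_cancel (hv0 _ _ ht₁) (hvt _ _), mul_one]
      _ = _ := by
          rw [ENNReal.mul_rpow_of_nonneg _ _ (by norm_num),
            show (4 : ℝ≥0∞) = 2 ^ (2 : ℝ) by norm_num, ← ENNReal.rpow_mul]
          norm_num
  have mass_le : ∫⁻ w, κ₂ w ≤ 1 := lintegral_le_one_of_lintegral_sq_le ht₂ hκ₂ hs₂ hn₂
  calc ∫⁻ w, ∫⁻ y, h (y + w) * (κ₁ y * κ₂ w)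
      ≤ ∫⁻ w, 2 * M ^ (1 / 2 : ℝ) * κ₂ w := by
        refine lintegral_mono fun w => ?_
        simp only [← mul_assoc]
        rw [lintegral_mul_const _ (by fun_prop)]
        by_cases hw : w ∈ Metric.ball c₂ t₂
        · gcongr
          exact inner_le w hw
        · simp [hs₂ w hw]
    _ ≤ 2 * M ^ (1 / 2 : ℝ) * 1 := by
        rw [lintegral_const_mul _ hκ₂]
        gcongr
    _ = _ := mul_one _

theorem ae_sin_sub_ne_zero : ∀ᵐ z : ℝ × ℝ, sin (z.1 - z.2) ≠ 0 := by
  rw [ae_iff, Measure.volume_eq_prod, Measure.measure_prod_null]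
  · refine Filter.Eventually.of_forall fun x => ?_
    refine Set.Countable.measure_zero ((Set.countable_range fun k : ℤ => x - k * π).mono ?_) _
    intro y hy
    have hy : sin (x - y) = 0 := by simpa using hy
    obtain ⟨k, hk⟩ := sin_eq_zero_iff.1 hy
    exact ⟨k, by simp only; linarith⟩
  · simp only [ne_eq, not_not]
    exact measurableSet_eq_fun (by fun_prop) (by fun_prop)

/-- The bilinear estimate on the circle underlying the restriction theorem. -/
theorem setLIntegral_mul_mul_comp_add_le {s : ℝ} (hs : 1 < s) (hs2 : s < 2) : ∃ C : ℝ≥0,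
    ∀ (g : ℝ → ℝ≥0∞) (H : Plane → ℝ≥0∞), Measurable g → Measurable H →
      ∫⁻ z in Set.Ioc 0 (2 * π) ×ˢ Set.Ioc 0 (2 * π),
        g z.1 * g z.2 * H (circlePoint z.1 + circlePoint z.2) ≤
      C * (∫⁻ w, H w ^ (s / (s - 1))) ^ ((s - 1) / s) *
        (∫⁻ x in Set.Ioc 0 (2 * π), g x ^ (2 * s / (3 - s))) ^ ((3 - s) / s) := by
  obtain ⟨C, hC⟩ := setLIntegral_abs_sin_rpow_le (α := s - 1) (by linarith) (by linarith)
  have hs0 : 0 < s := by linarith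
  have hs1 : 0 < s - 1 := by linarith
  have hc : (s / (s - 1)).HolderConjugate s := (Real.HolderConjugate.conjExponent hs).symm
  refine ⟨2 ^ ((s - 1) / s) * C ^ (1 / s), fun g H hg hH => ?_⟩
  set Q : Set (ℝ × ℝ) := Set.Ioc 0 (2 * π) ×ˢ Set.Ioc 0 (2 * π) with hQ
  set σ : ℝ × ℝ → ℝ := fun z => |sin (z.1 - z.2)| with hσ
  have hσm : Measurable σ := by fun_prop
  have hHm : Measurable fun z : ℝ × ℝ => H (circlePoint z.1 + circlePoint z.2) :=
    hH.comp ((measurable_circlePoint.comp measurable_fst).add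
      (measurable_circlePoint.comp measurable_snd))
  -- Hölder with exponents `s / (s - 1)` and `s`, after inserting `σ` to the powers `±(s - 1) / s`.
  -- The first factor acquires exactly the Jacobian; the second acquires `σ ^ (-(s - 1))`, a
  -- fractional kernel of order `α = s - 1 < 1`.
  have e1 : (∫⁻ z in Q, (ENNReal.ofReal (σ z ^ ((s - 1) / s)) *
      H (circlePoint z.1 + circlePoint z.2)) ^ (s / (s - 1)))
      ≤ 2 * ∫⁻ w, H w ^ (s / (s - 1)) := by
    refine le_trans (le_of_eq ?_) (setLIntegral_circlePoint_add_le fun w => H w ^ (s / (s - 1)))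
    congr 1 with z
    have : 0 ≤ σ z := abs_nonneg _
    rw [ENNReal.mul_rpow_of_nonneg _ _ (by positivity),
      ENNReal.ofReal_rpow_of_nonneg (by positivity) (by positivity), ← Real.rpow_mul this,
      div_mul_div_cancel₀ hs0.ne', div_self hs1.ne', Real.rpow_one]
  have e2 : (∫⁻ z in Q, (ENNReal.ofReal (σ z ^ (-((s - 1) / s))) * (g z.1 * g z.2)) ^ s)
      ≤ C * (∫⁻ x in Set.Ioc 0 (2 * π), g x ^ (2 * s / (3 - s))) ^ (3 - s) := by
    have := hC (fun x => g x ^ s) (by fun_prop)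
    simp only [← ENNReal.rpow_mul] at this
    rw [show s * (2 / (2 - (s - 1))) = 2 * s / (3 - s) by
      rw [show 2 - (s - 1) = 3 - s by ring]; ring, show 2 - (s - 1) = 3 - s by ring] at this
    refine le_trans (le_of_eq ?_) this
    congr 1 with z
    have : 0 ≤ σ z := abs_nonneg _
    rw [ENNReal.mul_rpow_of_nonneg _ _ hs0.le, ENNReal.mul_rpow_of_nonneg _ _ hs0.le,
      ENNReal.ofReal_rpow_of_nonneg (by positivity) (by positivity), ← Real.rpow_mul this,
      neg_mul, div_mul_cancel₀ _ hs0.ne']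
  calc _ = ∫⁻ z in Q, (ENNReal.ofReal (σ z ^ ((s - 1) / s)) *
        H (circlePoint z.1 + circlePoint z.2)) *
          (ENNReal.ofReal (σ z ^ (-((s - 1) / s))) * (g z.1 * g z.2)) := by
        refine lintegral_congr_ae (ae_restrict_of_ae ?_)
        filter_upwards [ae_sin_sub_ne_zero] with z hz
        have hz' : 0 < σ z := abs_pos.2 hz
        have : ENNReal.ofReal (σ z ^ ((s - 1) / s)) * ENNReal.ofReal (σ z ^ (-((s - 1) / s)))
            = 1 := by
          rw [← ENNReal.ofReal_mul (by positivity), ← Real.rpow_add hz']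
          simp
        rw [mul_mul_mul_comm, this, one_mul, mul_comm]
    _ ≤ (2 * ∫⁻ w, H w ^ (s / (s - 1))) ^ (1 / (s / (s - 1))) *
        (C * (∫⁻ x in Set.Ioc 0 (2 * π), g x ^ (2 * s / (3 - s))) ^ (3 - s)) ^ (1 / s) := by
        refine (ENNReal.lintegral_mul_le_Lp_mul_Lq _ hc
          ((hσm.pow_const _).ennreal_ofReal.mul hHm).aemeasurable
          ((hσm.pow_const _).ennreal_ofReal.mul
            ((hg.comp measurable_fst).mul (hg.comp measurable_snd))).aemeasurable).trans ?_
        exact mul_le_mul' (ENNReal.rpow_le_rpow e1 (by positivity))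
          (ENNReal.rpow_le_rpow e2 (by positivity))
    _ = _ := by
        rw [one_div_div, ENNReal.mul_rpow_of_nonneg _ _ (by positivity),
          ENNReal.mul_rpow_of_nonneg _ _ (by positivity), ← ENNReal.rpow_mul,
          show (3 - s) * (1 / s) = (3 - s) / s by ring, ENNReal.coe_mul,
          ENNReal.coe_rpow_of_nonneg _ (by positivity), ENNReal.coe_rpow_of_nonneg _ (by positivity)]
        push_cast
        ring

/-- The extension estimate: the self-convolution of a superposition `Γ` of kernels normalized in
`L²` on balls centred on the circle. -/
theorem lintegral_lconvolution_rpow_le {s : ℝ} (hs : 1 < s) (hs2 : s < 2) : ∃ C : ℝ≥0,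
    ∀ (g : ℝ → ℝ≥0∞) (t : ℝ → ℝ) (κ : ℝ × Plane → ℝ≥0∞) (Γ : Plane → ℝ≥0∞),
      Measurable g → Measurable κ → (∀ θ, 0 < t θ) →
      (∀ θ, ∀ y ∉ Metric.ball (circlePoint θ) (t θ), κ (θ, y) = 0) →
      (∀ θ, ∫⁻ y, κ (θ, y) ^ (2 : ℝ) ≤ (volume (Metric.ball (circlePoint θ) (t θ)))⁻¹) →
      (∀ y, Γ y = ∫⁻ θ in Set.Ioc 0 (2 * π), g θ * κ (θ, y)) →
      ∫⁻ z, (∫⁻ y, Γ y * Γ (z - y)) ^ s ≠ ∞ →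
      (∫⁻ z, (∫⁻ y, Γ y * Γ (z - y)) ^ s) ^ (1 / s) ≤
        C * (∫⁻ x in Set.Ioc 0 (2 * π), g x ^ (2 * s / (3 - s))) ^ ((3 - s) / s) := by
  obtain ⟨C, hC⟩ := setLIntegral_mul_mul_comp_add_le hs hs2
  have hs0 : 0 < s := by linarith
  have hs1 : 0 < s - 1 := by linarith
  -- Equivalent to `s < 2`: the quadratic maximal function is bounded on exponents above 2, here `s
  -- / (s - 1)`.
  have hs' : 1 < s / (s - 1) / 2 := by
    rw [div_div, one_lt_div (by positivity)]; linarith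
  obtain ⟨D, hD⟩ := lintegral_uncentredMaximal_rpow_le (volume : Measure Plane) hs'
  refine ⟨C * (2 * D ^ ((s - 1) / s)), fun g t κ Γ hg hκ ht hsupp hnorm hΓ hfin => ?_⟩
  set ν : Measure ℝ := volume.restrict (Set.Ioc 0 (2 * π)) with hν
  set N : Plane → ℝ≥0∞ := fun z => ∫⁻ y, Γ y * Γ (z - y) with hN
  have hΓm : Measurable Γ := by
    rw [funext hΓ]
    exact Measurable.lintegral_prod_right' (f := fun z : Plane × ℝ => g z.2 * κ (z.2, z.1))
      (by fun_prop)
  have hNm : Measurable N :=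
    Measurable.lintegral_prod_right' (f := fun z : Plane × Plane => Γ z.2 * Γ (z.1 - z.2))
      (by fun_prop)
  set X := ∫⁻ z, N z ^ s with hX
  set U := (∫⁻ x in Set.Ioc 0 (2 * π), g x ^ (2 * s / (3 - s))) ^ ((3 - s) / s)
  -- The function dual to `N`: `N ^ s = h * N`, and `h ^ (s / (s - 1)) = N ^ s`.
  set h : Plane → ℝ≥0∞ := fun z => N z ^ (s - 1) with hh
  have hhm : Measurable h := by fun_prop
  set H : Plane → ℝ≥0∞ := fun z =>
    2 * uncentredMaximal volume (fun y => h y ^ (2 : ℝ)) z ^ (1 / 2 : ℝ) with hH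
  have hHm : Measurable H := ((measurable_uncentredMaximal _ _).pow_const _).const_mul _
  have hHX : (∫⁻ w, H w ^ (s / (s - 1))) ^ ((s - 1) / s) ≤ 2 * D ^ ((s - 1) / s) *
      X ^ ((s - 1) / s) := by
    have h1 : ∫⁻ w, H w ^ (s / (s - 1)) ≤ 2 ^ (s / (s - 1)) * (D * X) := by
      calc ∫⁻ w, H w ^ (s / (s - 1)) = 2 ^ (s / (s - 1)) * ∫⁻ w,
            uncentredMaximal volume (fun y => h y ^ (2 : ℝ)) w ^ (s / (s - 1) / 2) := by
            rw [← lintegral_const_mul _ ((measurable_uncentredMaximal _ _).pow_const _)]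
            congr 1 with w
            rw [hH, ENNReal.mul_rpow_of_nonneg _ _ (by positivity), ← ENNReal.rpow_mul]
            congr 2
            ring
        _ ≤ 2 ^ (s / (s - 1)) * (D * ∫⁻ y, (h y ^ (2 : ℝ)) ^ (s / (s - 1) / 2)) := by
            gcongr
            exact hD _ (by fun_prop)
        _ = _ := by
            congr 3 with y
            rw [hh, ← ENNReal.rpow_mul, ← ENNReal.rpow_mul]
            congr 1
            field_simp
    refine (ENNReal.rpow_le_rpow h1 (by positivity)).trans_eq ?_
    rw [ENNReal.mul_rpow_of_nonneg _ _ (by positivity), ENNReal.mul_rpow_of_nonneg _ _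
      (by positivity), ← ENNReal.rpow_mul, div_mul_div_cancel₀ hs1.ne', div_self hs0.ne',
      ENNReal.rpow_one, mul_assoc]
  have hpair : ∀ z : ℝ × ℝ, ∫⁻ p : Plane × Plane, h (p.1 + p.2) *
      (κ (z.1, p.1) * κ (z.2, p.2)) ≤ H (circlePoint z.1 + circlePoint z.2) := by
    intro z
    -- The pair estimate puts the larger ball in the inner integral; the order of integration is
    -- chosen accordingly.
    rcases le_total (t z.2) (t z.1) with hle | hle
    · rw [Measure.volume_eq_prod, lintegral_prod_symm _ (by fun_prop)]
      exact lintegral_lintegral_mul_le_uncentredMaximal (ht _) hle (by fun_prop) (by fun_prop) hhm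
        (hsupp _) (hsupp _) (hnorm _) (hnorm _)
    · rw [Measure.volume_eq_prod, lintegral_prod _ (by fun_prop), add_comm (circlePoint z.1)]
      have := lintegral_lintegral_mul_le_uncentredMaximal (ht z.1) hle (κ₁ := fun y => κ (z.2, y))
        (κ₂ := fun y => κ (z.1, y)) (by fun_prop) (by fun_prop) hhm
        (hsupp _) (hsupp _) (hnorm _) (hnorm _)
      refine le_trans (le_of_eq ?_) this
      congr 1 with w
      congr 1 with y
      rw [add_comm w y, mul_comm (κ (z.1, w))]
  have hmain : X ≤ ∫⁻ z in Set.Ioc 0 (2 * π) ×ˢ Set.Ioc 0 (2 * π),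
        g z.1 * g z.2 * H (circlePoint z.1 + circlePoint z.2) := by
    calc X = ∫⁻ z, ∫⁻ y, h z * (Γ y * Γ (z - y)) := by
          rw [hX]
          congr 1 with z
          rw [lintegral_const_mul _ (by fun_prop), hh]
          conv_lhs => rw [show s = (s - 1) + 1 by ring]
          rw [ENNReal.rpow_add_of_nonneg _ _ hs1.le zero_le_one, ENNReal.rpow_one]
      _ = ∫⁻ y, ∫⁻ z, h z * (Γ y * Γ (z - y)) := lintegral_lintegral_swap (by fun_prop)
      _ = ∫⁻ y, ∫⁻ w, h (y + w) * (Γ y * Γ w) := by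
          congr 1 with y
          rw [← lintegral_add_left_eq_self _ y]
          congr 1 with w
          rw [add_sub_cancel_left]
      _ = ∫⁻ p : Plane × Plane, h (p.1 + p.2) * (Γ p.1 * Γ p.2) := by
          rw [Measure.volume_eq_prod, lintegral_prod _ (by fun_prop)]
      _ = ∫⁻ p : Plane × Plane, ∫⁻ z : ℝ × ℝ, h (p.1 + p.2) *
            ((g z.1 * κ (z.1, p.1)) * (g z.2 * κ (z.2, p.2))) ∂(ν.prod ν) := by
          congr 1 with p
          rw [lintegral_const_mul _ (by fun_prop), hΓ, hΓ, lintegral_prod_mul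
            (f := fun θ => g θ * κ (θ, p.1)) (g := fun θ => g θ * κ (θ, p.2))
            (by fun_prop) (by fun_prop)]
      _ = ∫⁻ z : ℝ × ℝ, (∫⁻ p : Plane × Plane, h (p.1 + p.2) *
            ((g z.1 * κ (z.1, p.1)) * (g z.2 * κ (z.2, p.2)))) ∂(ν.prod ν) :=
          lintegral_lintegral_swap (by fun_prop)
      _ ≤ ∫⁻ z : ℝ × ℝ, g z.1 * g z.2 * H (circlePoint z.1 + circlePoint z.2) ∂(ν.prod ν) := by
          refine lintegral_mono fun z => ?_
          refine le_trans (le_of_eq ?_) (mul_le_mul_right (hpair z) _)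
          rw [← lintegral_const_mul _ (by fun_prop)]
          congr 1 with p
          ring
      _ = _ := by rw [hν, Measure.prod_restrict, ← Measure.volume_eq_prod]
  -- A power of `X` reappears on the right; the assumed finiteness of `X` allows cancelling it.
  have hfinal : X ^ ((s - 1) / s) * X ^ (1 / s) ≤
      X ^ ((s - 1) / s) * ((C * (2 * D ^ ((s - 1) / s)) : ℝ≥0) * U) := by
    rw [← ENNReal.rpow_add_of_nonneg _ _ (by positivity) (by positivity),
      show (s - 1) / s + 1 / s = 1 by field_simp; ring, ENNReal.rpow_one]
    refine hmain.trans ((hC g H hg hHm).trans ?_)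
    refine (mul_le_mul_left (mul_le_mul_right hHX _) _).trans_eq ?_
    push_cast
    rw [ENNReal.coe_rpow_of_nonneg _ (by positivity)]
    ring
  by_cases hX0 : X = 0
  · rw [hX0, ENNReal.zero_rpow_of_pos (by positivity)]; exact zero_le
  · refine (ENNReal.mul_le_mul_iff_right ?_ ?_).1 hfinal
    · simp [hX0, hfin]
    · exact ENNReal.rpow_ne_top_of_nonneg (by positivity) hfin

end Extension

/-! ### Plancherel, the multiplication formula and Hausdorff–Young. -/

section Fourier

variable {V : Type*} [NormedAddCommGroup V] [InnerProductSpace ℝ V] [FiniteDimensional ℝ V]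
  [MeasurableSpace V] [BorelSpace V]

theorem continuous_fourier_of_integrable {f : V → ℂ} (hf : Integrable f) : Continuous (𝓕 f) :=
  VectorFourier.fourierIntegral_continuous Real.continuous_fourierChar continuous_inner hf

theorem enorm_fourier_le (f : V → ℂ) (ξ : V) : ‖𝓕 f ξ‖ₑ ≤ ∫⁻ x, ‖f x‖ₑ := by
  rw [Real.fourier_eq]
  refine (enorm_integral_le_lintegral_enorm _).trans_eq ?_
  congr 1 with x
  rw [← ofReal_norm, ← ofReal_norm, Circle.norm_smul]

theorem integral_fourier_mul_eq {f g : V → ℂ} (hf : Integrable f) (hg : Integrable g) :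
    ∫ ξ, 𝓕 f ξ * g ξ = ∫ x, f x * 𝓕 g x := by
  simpa using! VectorFourier.integral_bilin_fourierIntegral_eq_flip (ContinuousLinearMap.mul ℂ ℂ)
    (L := innerₗ V) Real.continuous_fourierChar continuous_inner hf hg

/-- The Plancherel extension agrees with the Fourier integral on `L¹ ∩ L²`. -/
theorem fourier_toLp_ae_eq {f : V → ℂ} (hf : Integrable f) (hf2 : MemLp f 2) :
    (𝓕 (hf2.toLp f) : Lp (α := V) ℂ 2 volume) =ᵐ[volume] 𝓕 f := by
  have hloc : LocallyIntegrable
      (fun x => (𝓕 (hf2.toLp f) : Lp (α := V) ℂ 2 volume) x - 𝓕 f x) volume :=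
    ((Lp.memLp _).locallyIntegrable (by norm_num)).sub
      (continuous_fourier_of_integrable hf).locallyIntegrable
  have := ae_eq_zero_of_integral_contDiff_smul_eq_zero hloc ?_
  · filter_upwards [this] with x hx
    exact sub_eq_zero.1 hx
  intro g g_smooth g_cpt
  have hg₁ : HasCompactSupport (Complex.ofRealCLM ∘ g) := g_cpt.comp_left rfl
  have hg₂ : ContDiff ℝ ((⊤ : ℕ∞) : WithTop ℕ∞) (Complex.ofRealCLM ∘ g) := by fun_prop
  -- The Plancherel transform is known here through its action as a tempered distribution; testing
  -- against all such `ψ` identifies it almost everywhere.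
  set ψ : SchwartzMap V ℂ := hg₁.toSchwartzMap hg₂ with hψ
  have hψg : ∀ x, ψ x = g x := fun x => rfl
  have e1 := congrArg (fun T => T ψ) (Lp.fourier_toTemperedDistribution_eq (hf2.toLp f))
  simp only [TemperedDistribution.fourier_apply, Lp.toTemperedDistribution_apply] at e1
  have e2 : ∫ x, (𝓕 ψ) x • (hf2.toLp f) x = ∫ x, ψ x * 𝓕 f x := by
    rw [← integral_fourier_mul_eq ψ.integrable hf]
    refine integral_congr_ae ?_
    filter_upwards [hf2.coeFn_toLp] with x hx
    rw [hx, smul_eq_mul, SchwartzMap.fourier_coe]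
  have i1 : Integrable fun x => g x • (𝓕 (hf2.toLp f) : Lp (α := V) ℂ 2 volume) x :=
    ((Lp.memLp _).locallyIntegrable (by norm_num)).integrable_smul_left_of_hasCompactSupport
      g_smooth.continuous g_cpt
  have i2 : Integrable fun x => g x • 𝓕 f x :=
    (continuous_fourier_of_integrable hf).locallyIntegrable.integrable_smul_left_of_hasCompactSupport
      g_smooth.continuous g_cpt
  simp only [smul_sub]
  rw [integral_sub i1 i2, sub_eq_zero]
  have e3 := e1.symm.trans e2
  simpa [hψg] using e3

/-- Plancherel's theorem on `L¹ ∩ L²`. -/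
theorem lintegral_enorm_fourier_sq {f : V → ℂ} (hf : Integrable f) (hf2 : MemLp f 2) :
    ∫⁻ ξ, ‖𝓕 f ξ‖ₑ ^ (2 : ℝ) = ∫⁻ x, ‖f x‖ₑ ^ (2 : ℝ) := by
  have h1 : eLpNorm (𝓕 f) 2 volume = eLpNorm f 2 volume := by
    rw [← eLpNorm_congr_ae (fourier_toLp_ae_eq hf hf2), ← eLpNorm_congr_ae hf2.coeFn_toLp,
      ← Lp.enorm_def, ← Lp.enorm_def, ← ofReal_norm, ← ofReal_norm, Lp.norm_fourier_eq]
  rw [eLpNorm_eq_lintegral_rpow_enorm_toReal (by norm_num) (by norm_num),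
    eLpNorm_eq_lintegral_rpow_enorm_toReal (by norm_num) (by norm_num)] at h1
  simpa using (ENNReal.rpow_left_injective (by norm_num)) h1

theorem memLp_fourier {f : V → ℂ} (hf : Integrable f) (hf2 : MemLp f 2) : MemLp (𝓕 f) 2 :=
  (memLp_congr_ae (fourier_toLp_ae_eq hf hf2)).1 (Lp.memLp _)

/-- The multiplication formula for the Plancherel extension. -/
theorem integral_fourier_toLp_mul_eq (a : Lp (α := V) ℂ 2 volume) {g : V → ℂ} (hg : Integrable g)
    (hg2 : MemLp g 2) : ∫ ξ, (𝓕 a : Lp (α := V) ℂ 2 volume) ξ * g ξ = ∫ x, a x * 𝓕 g x := by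
  have hstar : ∀ {k : V → ℂ}, MemLp k 2 → MemLp (fun x => (starRingEnd ℂ) (k x)) 2 :=
    fun hk => hk.star
  have hinner : ∀ {k : V → ℂ} (hk : MemLp k 2) (b : Lp (α := V) ℂ 2 volume),
      ∫ x, b x * k x = inner ℂ ((hstar hk).toLp _) b := by
    intro k hk b
    rw [L2.inner_def]
    refine integral_congr_ae ?_
    filter_upwards [(hstar hk).coeFn_toLp] with x hx
    rw [hx]
    simp
  have hĝ := memLp_fourier hg hg2
  rw [hinner hg2, hinner hĝ]
  -- Written as inner products against conjugates, both sides are continuous in `a` on L², so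
  -- Schwartz functions suffice.
  refine DenseRange.induction_on (p := fun a : Lp (α := V) ℂ 2 volume =>
    inner ℂ ((hstar hg2).toLp _) (𝓕 a) = inner ℂ ((hstar hĝ).toLp _) a)
    (SchwartzMap.denseRange_toLpCLM (p := 2) ENNReal.ofNat_ne_top) a ?_ ?_
  · exact isClosed_eq (continuous_const.inner (Lp.fourierTransformₗᵢ V ℂ).continuous)
      (continuous_const.inner continuous_id)
  · intro ψ
    rw [← hinner hg2, ← hinner hĝ]
    have h1 := SchwartzMap.toLp_fourier_eq ψ
    have h2 : ∫ ξ, (𝓕 ψ) ξ * g ξ = ∫ x, ψ x * 𝓕 g x := by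
      rw [← integral_fourier_mul_eq ψ.integrable hg, SchwartzMap.fourier_coe]
    calc _ = ∫ ξ, (𝓕 ψ) ξ * g ξ := by
          refine integral_congr_ae ?_
          rw [SchwartzMap.toLpCLM_apply, h1]
          filter_upwards [(𝓕 ψ).coeFn_toLp 2 volume] with x hx
          rw [hx]
      _ = _ := h2
      _ = _ := by
          refine integral_congr_ae ?_
          rw [SchwartzMap.toLpCLM_apply]
          filter_upwards [ψ.coeFn_toLp 2 volume] with x hx
          rw [hx]

theorem fourier_add_apply {f g : V → ℂ} (hf : Integrable f) (hg : Integrable g) (ξ : V) :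
    𝓕 (f + g) ξ = 𝓕 f ξ + 𝓕 g ξ := by
  rw [Real.fourier_eq, Real.fourier_eq, Real.fourier_eq,
    ← integral_add ((Real.fourierIntegral_convergent_iff ξ).2 hf)
      ((Real.fourierIntegral_convergent_iff ξ).2 hg)]
  simp only [Pi.add_apply, smul_add]

/-- The Hausdorff–Young inequality, up to a constant. -/
theorem lintegral_enorm_fourier_rpow_le {s : ℝ} (hs : 1 < s) (hs2 : s < 2) : ∃ C : ℝ≥0,
    ∀ u : V → ℂ, Measurable u → Integrable u → ∫⁻ x, ‖u x‖ₑ ^ s ≠ ∞ →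
      ∫⁻ ξ, ‖𝓕 u ξ‖ₑ ^ (s / (s - 1)) ≤ C * (∫⁻ x, ‖u x‖ₑ ^ s) ^ (1 / (s - 1)) := by
  have hs0 : 0 < s := by linarith
  have hs1 : 0 < s - 1 := by linarith
  set b : ℝ := s / (s - 1) with hb
  have hb2 : 2 < b := by rw [hb, lt_div_iff₀ hs1]; linarith
  have hb1 : 1 / (s - 1) = b - 2 + 1 := by rw [hb]; field_simp; ring
  have hsb : (s - 1) * (b - 2) = 2 - s := by rw [hb]; field_simp; ring
  set K : ℝ≥0∞ := ENNReal.ofReal b * (4 * (2 ^ (b - 2) / ENNReal.ofReal (b - 2))) with hK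
  have hKt : K ≠ ∞ := by
    refine ENNReal.mul_ne_top ENNReal.ofReal_ne_top (ENNReal.mul_ne_top (by simp)
      (ENNReal.div_ne_top (ENNReal.rpow_ne_top_of_nonneg (by linarith) (by simp)) ?_))
    simpa using hb2
  refine ⟨K.toNNReal, fun u hu hui hfin => ?_⟩
  rw [ENNReal.coe_toNNReal hKt]
  set A := ∫⁻ x, ‖u x‖ₑ ^ s with hA
  by_cases hA0 : A = 0
  · have hz : u =ᵐ[volume] 0 := by
      rw [hA, lintegral_eq_zero_iff (by fun_prop)] at hA0
      filter_upwards [hA0] with x hx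
      simpa [hs0, hs0.le, not_lt.2 hs0.le] using hx
    have : ∀ ξ, 𝓕 u ξ = 0 := by
      intro ξ
      rw [Real.fourier_congr_ae hz, Real.fourier_eq]
      simp
    simp [this, show 0 < b by linarith]
  -- Interpolation between L¹ and L² with a cutoff adapted to the level. Where `F x ≤ l` one has `2
  -- * A ≤ l * ‖u x‖ₑ ^ (s - 1)`, so this large part of `u` has L¹ norm at most `l / 2` and its
  -- transform never exceeds `l / 2`. The rest is bounded, hence in L², and Plancherel with
  -- Chebyshev applies. Including `A` in the cutoff gives the homogeneous bound.
  set F : V → ℝ≥0∞ := fun x => 2 * A / ‖u x‖ₑ ^ (s - 1) with hF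
  have hFm : Measurable F := by fun_prop
  have step : ∀ l ∈ Set.Ioi (0 : ℝ), ENNReal.ofReal (l ^ (b - 1)) *
      volume {ξ | ENNReal.ofReal l < ‖𝓕 u ξ‖ₑ} ≤
      4 * (ENNReal.ofReal (l ^ (b - 3)) *
        ∫⁻ x in {x | ENNReal.ofReal l < F x}, ‖u x‖ₑ ^ (2 : ℝ)) := by
    intro l hl
    have hl : 0 < l := hl
    have hl0 : ENNReal.ofReal l ≠ 0 := by simpa using hl
    set S : Set V := {x | ENNReal.ofReal l < F x} with hS
    have hSm : MeasurableSet S := measurableSet_lt measurable_const hFm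
    have hlow : Integrable (S.indicator u) := hui.indicator hSm
    have hhigh : Integrable (Sᶜ.indicator u) := hui.indicator hSm.compl
    have hbound : ∀ x, ‖S.indicator u x‖ₑ ≤ (2 * A / ENNReal.ofReal l) ^ (1 / (s - 1)) := by
      intro x
      by_cases hx : x ∈ S
      · rw [Set.indicator_of_mem hx]
        have h1 : ENNReal.ofReal l < 2 * A / ‖u x‖ₑ ^ (s - 1) := hx
        have h2 : ‖u x‖ₑ ^ (s - 1) ≠ ∞ := ENNReal.rpow_ne_top_of_nonneg hs1.le enorm_ne_top
        have h3 : ‖u x‖ₑ ^ (s - 1) ≤ 2 * A / ENNReal.ofReal l := by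
          rw [ENNReal.le_div_iff_mul_le (Or.inl hl0) (Or.inl ENNReal.ofReal_ne_top), mul_comm]
          by_cases h0 : ‖u x‖ₑ ^ (s - 1) = 0
          · simp [h0]
          · exact ((ENNReal.le_div_iff_mul_le (Or.inl h0) (Or.inl h2)).1 h1.le)
        calc ‖u x‖ₑ = (‖u x‖ₑ ^ (s - 1)) ^ (1 / (s - 1)) := by
              rw [← ENNReal.rpow_mul, mul_one_div_cancel hs1.ne', ENNReal.rpow_one]
          _ ≤ _ := by gcongr
      · simp [hx]
    have hlow2 : MemLp (S.indicator u) 2 := by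
      refine ⟨hlow.aestronglyMeasurable, ?_⟩
      rw [eLpNorm_lt_top_iff_lintegral_rpow_enorm_lt_top (by norm_num) (by norm_num)]
      set B := (2 * A / ENNReal.ofReal l) ^ (1 / (s - 1))
      have hB : B ≠ ∞ := ENNReal.rpow_ne_top_of_nonneg (by positivity) (ENNReal.div_ne_top
        (ENNReal.mul_ne_top (by simp) hfin) hl0)
      calc ∫⁻ x, ‖S.indicator u x‖ₑ ^ (2 : ℝ≥0∞).toReal
          ≤ ∫⁻ x, B * ‖S.indicator u x‖ₑ := by
            refine lintegral_mono fun x => ?_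
            rw [ENNReal.toReal_ofNat, ENNReal.rpow_two, sq]
            exact mul_le_mul_left (hbound x) _
        _ < ∞ := by
            rw [lintegral_const_mul' _ _ hB]
            exact ENNReal.mul_lt_top hB.lt_top hlow.hasFiniteIntegral
    have hmass : ∫⁻ x, ‖Sᶜ.indicator u x‖ₑ ≤ ENNReal.ofReal (l / 2) := by
      have h2A0 : 2 * A ≠ 0 := by simp [hA0]
      have h2At : 2 * A ≠ ∞ := ENNReal.mul_ne_top (by simp) hfin
      have h1 : (∫⁻ x, ‖Sᶜ.indicator u x‖ₑ) * (2 * A) ≤ ENNReal.ofReal l * A := by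
        rw [← lintegral_mul_const' _ _ h2At]
        conv_rhs => rw [hA, ← lintegral_const_mul _ (by fun_prop)]
        refine lintegral_mono fun x => ?_
        by_cases hx : x ∈ S
        · simp [hx]
        · rw [Set.indicator_of_mem (show x ∈ Sᶜ from hx)]
          have h1 : 2 * A / ‖u x‖ₑ ^ (s - 1) ≤ ENNReal.ofReal l := not_lt.1 hx
          have h2 : ‖u x‖ₑ ^ (s - 1) ≠ ∞ := ENNReal.rpow_ne_top_of_nonneg hs1.le enorm_ne_top
          have h3 : 2 * A ≤ ENNReal.ofReal l * ‖u x‖ₑ ^ (s - 1) := by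
            refine (ENNReal.div_le_iff_le_mul (Or.inr ?_) (Or.inl h2)).1 h1
            exact ENNReal.ofReal_ne_top
          refine (mul_le_mul_right h3 _).trans_eq ?_
          rw [mul_left_comm]
          congr 1
          conv_rhs => rw [show s = 1 + (s - 1) by ring]
          rw [ENNReal.rpow_add_of_nonneg _ _ zero_le_one hs1.le, ENNReal.rpow_one]
      rw [← ENNReal.le_div_iff_mul_le (Or.inl h2A0) (Or.inl h2At)] at h1
      refine h1.trans_eq ?_
      rw [ENNReal.mul_div_mul_right _ _ hA0 hfin, ENNReal.ofReal_div_of_pos two_pos]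
      simp
    have hsub : {ξ | ENNReal.ofReal l < ‖𝓕 u ξ‖ₑ} ⊆
        {ξ | ENNReal.ofReal (l / 2) ^ (2 : ℝ) ≤ ‖𝓕 (S.indicator u) ξ‖ₑ ^ (2 : ℝ)} := by
      intro ξ hξ
      have hξ : ENNReal.ofReal l < ‖𝓕 u ξ‖ₑ := hξ
      refine ENNReal.rpow_le_rpow ?_ (by norm_num)
      have hsplit : 𝓕 u ξ = 𝓕 (S.indicator u) ξ + 𝓕 (Sᶜ.indicator u) ξ := by
        rw [← fourier_add_apply hlow hhigh, Set.indicator_self_add_compl]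
      have h1 : ENNReal.ofReal (l / 2) + ENNReal.ofReal (l / 2) ≤
          ‖𝓕 (S.indicator u) ξ‖ₑ + ENNReal.ofReal (l / 2) := by
        rw [← ENNReal.ofReal_add (by positivity) (by positivity), add_halves]
        refine hξ.le.trans ?_
        rw [hsplit]
        exact (enorm_add_le _ _).trans (add_le_add_right ((enorm_fourier_le _ _).trans hmass) _)
      exact (ENNReal.add_le_add_iff_right ENNReal.ofReal_ne_top).1 h1
    have hl2 : ENNReal.ofReal (l / 2) ^ (2 : ℝ) = ENNReal.ofReal (l ^ (2 : ℝ) / 4) := by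
      rw [ENNReal.ofReal_rpow_of_pos (by positivity), Real.div_rpow hl.le (by norm_num)]
      norm_num
    have hcheb : volume {ξ | ENNReal.ofReal l < ‖𝓕 u ξ‖ₑ} ≤
        (∫⁻ x in S, ‖u x‖ₑ ^ (2 : ℝ)) / ENNReal.ofReal (l ^ (2 : ℝ) / 4) := by
      refine (measure_mono hsub).trans ?_
      refine (meas_ge_le_lintegral_div ?_ ?_ ?_).trans_eq ?_
      · exact ((continuous_fourier_of_integrable hlow).enorm.measurable.pow_const _).aemeasurable
      · simp [hl]
      · exact ENNReal.rpow_ne_top_of_nonneg (by norm_num) ENNReal.ofReal_ne_top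
      · rw [lintegral_enorm_fourier_sq hlow hlow2, hl2, ← lintegral_indicator hSm]
        congr 2 with x
        by_cases hx : x ∈ S <;> simp [hx]
    refine (mul_le_mul_right hcheb _).trans_eq ?_
    rw [div_eq_mul_inv, ← ENNReal.ofReal_inv_of_pos (by positivity), mul_comm (∫⁻ x in S, _),
      ← mul_assoc, ← mul_assoc, ← ENNReal.ofReal_mul (by positivity),
      show (4 : ℝ≥0∞) = ENNReal.ofReal 4 by simp, ← ENNReal.ofReal_mul (by norm_num)]
    congr 2
    rw [show b - 3 = b - 1 - 2 by ring, Real.rpow_sub hl (b - 1) 2]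
    field_simp
  rw [lintegral_rpow_eq_lintegral_superlevel
    (continuous_fourier_of_integrable hui).enorm.measurable (by linarith : 0 < b)]
  calc _ ≤ ENNReal.ofReal b * ∫⁻ l in Set.Ioi (0 : ℝ), 4 * (ENNReal.ofReal (l ^ (b - 3)) *
        ∫⁻ x in {x | ENNReal.ofReal l < F x}, ‖u x‖ₑ ^ (2 : ℝ)) :=
        mul_le_mul_right (setLIntegral_mono' measurableSet_Ioi step) _
    _ ≤ ENNReal.ofReal b * (4 * ∫⁻ x, (2 * A) ^ (b - 2) / ENNReal.ofReal (b - 2) * ‖u x‖ₑ ^ s) := by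
        rw [lintegral_const_mul' _ _ (by simp),
          lintegral_rpow_mul_setLIntegral hFm (by fun_prop) (by linarith)]
        refine mul_le_mul_right (mul_le_mul_right (lintegral_mono fun x => ?_) _) _
        rw [show b - 3 + 1 = b - 2 by ring, hF, div_eq_mul_inv _ (ENNReal.ofReal _),
          div_eq_mul_inv _ (ENNReal.ofReal _), ← mul_assoc, mul_right_comm _ _ (_ ^ s)]
        refine mul_le_mul_left ?_ _
        by_cases h0 : ‖u x‖ₑ = 0
        · simp [h0]
        rw [ENNReal.div_rpow_of_nonneg _ _ (by linarith), ← ENNReal.rpow_mul, hsb, div_eq_mul_inv,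
          mul_left_comm, ← ENNReal.rpow_neg, ← ENNReal.rpow_add _ _ h0 enorm_ne_top]
        refine le_of_eq ?_
        congr 2
        ring
    _ = _ := by
        rw [lintegral_const_mul _ (by fun_prop), hb1, ENNReal.rpow_add_of_nonneg _ _ (by linarith)
          zero_le_one, ENNReal.rpow_one, ENNReal.mul_rpow_of_nonneg _ _ (by linarith), hK,
          div_eq_mul_inv, div_eq_mul_inv]
        ring

end Fourier

/-! ### The Fourier transform on L^p of the plane. -/

section FourierPlane

theorem integrable_indicator_one_lt_norm {f : Plane → ℂ} {p : ℝ≥0∞} (hp : 1 ≤ p) (hpt : p ≠ ∞)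
    (hf : MemLp f p) : Integrable ({x | 1 < ‖f x‖}.indicator f) := by
  have hp1 : 1 ≤ p.toReal := by
    rw [← ENNReal.toReal_one]; exact ENNReal.toReal_mono hpt hp
  refine ⟨hf.1.indicator₀ (nullMeasurableSet_lt aemeasurable_const hf.1.norm.aemeasurable), ?_⟩
  have hfin := (eLpNorm_lt_top_iff_lintegral_rpow_enorm_lt_top (by positivity) hpt).1 hf.2
  refine lt_of_le_of_lt (lintegral_mono fun x => ?_) hfin
  by_cases hx : 1 < ‖f x‖
  · rw [Set.indicator_of_mem (show x ∈ {x | 1 < ‖f x‖} from hx)]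
    have : 1 ≤ ‖f x‖ₑ := by
      rw [← ofReal_norm, ← ENNReal.ofReal_one]; exact ENNReal.ofReal_le_ofReal hx.le
    calc ‖f x‖ₑ = ‖f x‖ₑ ^ (1 : ℝ) := (ENNReal.rpow_one _).symm
      _ ≤ _ := ENNReal.rpow_le_rpow_of_exponent_le this hp1
  · rw [Set.indicator_of_notMem (show x ∉ {x | 1 < ‖f x‖} from hx), enorm_zero]
    exact zero_le

theorem memLp_two_indicator_norm_le_one {f : Plane → ℂ} {p : ℝ≥0∞} (hp : 1 ≤ p) (hp2 : p ≤ 2)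
    (hf : MemLp f p) : MemLp ({x | ‖f x‖ ≤ 1}.indicator f) 2 := by
  have hpt : p ≠ ∞ := (lt_of_le_of_lt hp2 (by norm_num)).ne
  have hp2' : p.toReal ≤ 2 := by
    rw [← ENNReal.toReal_ofNat]; exact ENNReal.toReal_mono (by norm_num) hp2
  have hp0 : p ≠ 0 := by positivity
  refine ⟨hf.1.indicator₀ (nullMeasurableSet_le hf.1.norm.aemeasurable aemeasurable_const), ?_⟩
  have hfin := (eLpNorm_lt_top_iff_lintegral_rpow_enorm_lt_top hp0 hpt).1 hf.2
  rw [eLpNorm_lt_top_iff_lintegral_rpow_enorm_lt_top (by norm_num) (by norm_num)]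
  refine lt_of_le_of_lt (lintegral_mono fun x => ?_) hfin
  by_cases hx : ‖f x‖ ≤ 1
  · rw [Set.indicator_of_mem (show x ∈ {x | ‖f x‖ ≤ 1} from hx)]
    have : ‖f x‖ₑ ≤ 1 := by
      rw [← ofReal_norm, ← ENNReal.ofReal_one]; exact ENNReal.ofReal_le_ofReal hx
    exact ENNReal.rpow_le_rpow_of_exponent_ge this (by simpa using hp2')
  · rw [Set.indicator_of_notMem (show x ∉ {x | ‖f x‖ ≤ 1} from hx)]
    simp

theorem indicator_one_lt_norm_add (f : Plane → ℂ) :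
    {x | 1 < ‖f x‖}.indicator f + {x | ‖f x‖ ≤ 1}.indicator f = f := by
  ext x
  by_cases hx : 1 < ‖f x‖
  · simp [Set.indicator, hx, not_le.2 hx]
  · simp [Set.indicator, hx, not_lt.1 hx]

theorem measurable_fourierPlaneL2 (f : Plane → ℂ) : Measurable (fourierPlaneL2 f) := by
  unfold fourierPlaneL2
  split_ifs with h
  · exact (Lp.stronglyMeasurable _).measurable
  · exact measurable_const

theorem memLp_fourierPlaneL2 (f : Plane → ℂ) : MemLp (fourierPlaneL2 f) 2 := by
  unfold fourierPlaneL2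
  split_ifs with h
  · exact Lp.memLp _
  · exact MemLp.zero

theorem measurable_fourierPlane {f : Plane → ℂ} {p : ℝ≥0∞} (hp : 1 ≤ p) (hpt : p ≠ ∞)
    (hf : MemLp f p) : Measurable (fourierPlane f) :=
  (continuous_fourier_of_integrable (integrable_indicator_one_lt_norm hp hpt hf)).measurable.add
    (measurable_fourierPlaneL2 _)

/-- On `L¹`, the extended Fourier transform is the Fourier integral. -/
theorem fourierPlane_ae_eq {f : Plane → ℂ} (hf : Integrable f) : fourierPlane f =ᵐ[volume] 𝓕 f := by
  have hf1 : MemLp f 1 := memLp_one_iff_integrable.2 hf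
  have hhi := integrable_indicator_one_lt_norm le_rfl (by simp) hf1
  have hlo2 := memLp_two_indicator_norm_le_one le_rfl (by norm_num) hf1
  have hlo : Integrable ({x | ‖f x‖ ≤ 1}.indicator f) := by
    have := hf.sub hhi
    rwa [sub_eq_of_eq_add' (indicator_one_lt_norm_add f).symm] at this
  filter_upwards [fourier_toLp_ae_eq hlo hlo2] with ξ hξ
  conv_rhs => rw [← indicator_one_lt_norm_add f]
  rw [fourier_add_apply hhi hlo, fourierPlane, Pi.add_apply, fourierPlaneL2, dif_pos hlo2, hξ]

/-- The multiplication formula for the Fourier transform on `L^p`, `1 ≤ p ≤ 2`. -/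
theorem integral_fourierPlane_mul_eq {f : Plane → ℂ} {p : ℝ≥0∞} (hp : 1 ≤ p) (hp2 : p ≤ 2)
    (hf : MemLp f p) {G : Plane → ℂ} (hG : Integrable G) (hG2 : MemLp G 2) :
    ∫ ξ, fourierPlane f ξ * G ξ = ∫ x, f x * 𝓕 G x := by
  have hpt : p ≠ ∞ := (lt_of_le_of_lt hp2 (by norm_num)).ne
  have hhi := integrable_indicator_one_lt_norm hp hpt hf
  have hlo2 := memLp_two_indicator_norm_le_one hp hp2 hf
  set hi := {x | 1 < ‖f x‖}.indicator f with hhi_def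
  set lo := {x | ‖f x‖ ≤ 1}.indicator f with hlo_def
  have bdd : ∀ {k : Plane → ℂ}, Integrable k → ∃ C, ∀ ξ, ‖𝓕 k ξ‖ ≤ C := by
    intro k hk
    refine ⟨(∫⁻ x, ‖k x‖ₑ).toReal, fun ξ => ?_⟩
    rw [← toReal_enorm]
    exact ENNReal.toReal_mono hk.hasFiniteIntegral.ne (enorm_fourier_le k ξ)
  obtain ⟨C₁, hC₁⟩ := bdd hhi
  obtain ⟨C₂, hC₂⟩ := bdd hG
  have i1 : Integrable fun ξ => 𝓕 hi ξ * G ξ :=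
    hG.bdd_mul (continuous_fourier_of_integrable hhi).aestronglyMeasurable
      (Filter.Eventually.of_forall hC₁)
  have i2 : Integrable fun ξ => fourierPlaneL2 lo ξ * G ξ :=
    (memLp_fourierPlaneL2 lo).integrable_mul hG2
  have i3 : Integrable fun x => hi x * 𝓕 G x :=
    hhi.mul_bdd (continuous_fourier_of_integrable hG).aestronglyMeasurable
      (Filter.Eventually.of_forall hC₂)
  have i4 : Integrable fun x => lo x * 𝓕 G x := hlo2.integrable_mul (memLp_fourier hG hG2)
  have e2 : ∫ ξ, fourierPlaneL2 lo ξ * G ξ = ∫ x, lo x * 𝓕 G x := by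
    rw [fourierPlaneL2, dif_pos hlo2, integral_fourier_toLp_mul_eq _ hG hG2]
    refine integral_congr_ae ?_
    filter_upwards [hlo2.coeFn_toLp] with x hx
    rw [hx]
  calc ∫ ξ, fourierPlane f ξ * G ξ = ∫ ξ, (𝓕 hi ξ * G ξ + fourierPlaneL2 lo ξ * G ξ) := by
        congr 1 with ξ
        rw [fourierPlane, Pi.add_apply, add_mul]
    _ = ∫ x, (hi x * 𝓕 G x + lo x * 𝓕 G x) := by
        rw [integral_add i1 i2, integral_add i3 i4, integral_fourier_mul_eq hhi hG, e2]
    _ = _ := by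
        congr 1 with x
        rw [← add_mul, ← Pi.add_apply, indicator_one_lt_norm_add]

/-- `fourierPlane f` is square integrable on balls, uniformly in the centre. -/
theorem setLIntegral_ball_fourierPlane_le {f : Plane → ℂ} {p : ℝ≥0∞} (hp : 1 ≤ p) (hp2 : p ≤ 2)
    (hf : MemLp f p) : ∃ B : ℝ≥0, ∀ (x : Plane) (t : ℝ),
      ∫⁻ y in Metric.ball x t, ‖fourierPlane f y‖ₑ ^ (2 : ℝ) ≤
        B * volume (Metric.ball x t) + B := by
  have hpt : p ≠ ∞ := (lt_of_le_of_lt hp2 (by norm_num)).ne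
  have hhi := integrable_indicator_one_lt_norm hp hpt hf
  set hi := {x | 1 < ‖f x‖}.indicator f with hhi_def
  set lo := {x | ‖f x‖ ≤ 1}.indicator f with hlo_def
  set b₁ := ∫⁻ x, ‖hi x‖ₑ
  have hb₁ : b₁ ≠ ∞ := hhi.hasFiniteIntegral.ne
  set b₂ := ∫⁻ x, ‖fourierPlaneL2 lo x‖ₑ ^ (2 : ℝ) with hb₂_def
  have hb₂ : b₂ ≠ ∞ := by
    have := (eLpNorm_lt_top_iff_lintegral_rpow_enorm_lt_top (by norm_num) (by norm_num)).1
      (memLp_fourierPlaneL2 lo).2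
    rw [ENNReal.toReal_ofNat] at this
    exact this.ne
  have hB : 2 * (b₁ ^ (2 : ℝ) + b₂) ≠ ∞ := ENNReal.mul_ne_top (by simp)
    (ENNReal.add_ne_top.2 ⟨ENNReal.rpow_ne_top_of_nonneg (by norm_num) hb₁, hb₂⟩)
  -- The transform is a bounded function plus an L² function. Only the finiteness of this constant
  -- is used later.
  refine ⟨(2 * (b₁ ^ (2 : ℝ) + b₂)).toNNReal, fun x t => ?_⟩
  rw [ENNReal.coe_toNNReal hB]
  have hsq : ∀ a b : ℝ≥0∞, (a + b) ^ (2 : ℝ) ≤ 2 * (a ^ (2 : ℝ) + b ^ (2 : ℝ)) := by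
    intro a b
    have := ENNReal.rpow_add_le_mul_rpow_add_rpow a b (p := 2) (by norm_num)
    norm_num at this ⊢
    exact this
  calc ∫⁻ y in Metric.ball x t, ‖fourierPlane f y‖ₑ ^ (2 : ℝ)
      ≤ ∫⁻ y in Metric.ball x t, (2 * b₁ ^ (2 : ℝ) + 2 * ‖fourierPlaneL2 lo y‖ₑ ^ (2 : ℝ)) := by
        refine lintegral_mono fun y => ?_
        refine (ENNReal.rpow_le_rpow ((enorm_add_le _ _).trans
          (add_le_add_left (enorm_fourier_le hi y) _)) (by norm_num)).trans ?_
        rw [← mul_add]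
        exact hsq _ _
    _ = 2 * b₁ ^ (2 : ℝ) * volume (Metric.ball x t) +
        2 * ∫⁻ y in Metric.ball x t, ‖fourierPlaneL2 lo y‖ₑ ^ (2 : ℝ) := by
        rw [lintegral_add_left measurable_const, setLIntegral_const,
          lintegral_const_mul' _ _ (by simp)]
    _ ≤ _ := by
        gcongr
        · exact le_self_add
        · exact (setLIntegral_le_lintegral _ _).trans le_add_self

end FourierPlane

/-! ### The dual estimate, by squaring. -/

section DualEstimate

open Real

/-- The extension estimate for the Fourier transform of functions dominated by superpositions of
kernels normalized in `L²` on balls centred on the circle. -/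
theorem lintegral_enorm_fourier_rpow_le_of_le_superposition {s : ℝ} (hs : 1 < s) (hs2 : s < 2) :
    ∃ C : ℝ≥0, ∀ (g : ℝ → ℝ≥0∞) (t : ℝ → ℝ) (κ : ℝ × Plane → ℝ≥0∞) (Γ : Plane → ℝ≥0∞) (G : Plane → ℂ),
      Measurable g → Measurable κ → (∀ θ, 0 < t θ) →
      (∀ θ, ∀ y ∉ Metric.ball (circlePoint θ) (t θ), κ (θ, y) = 0) →
      (∀ θ, ∫⁻ y, κ (θ, y) ^ (2 : ℝ) ≤ (volume (Metric.ball (circlePoint θ) (t θ)))⁻¹) →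
      (∀ y, Γ y = ∫⁻ θ in Set.Ioc 0 (2 * π), g θ * κ (θ, y)) →
      ∫⁻ y, Γ y ≠ ∞ → ∫⁻ y, Γ y ^ (2 : ℝ) ≠ ∞ → Measurable G → (∀ y, ‖G y‖ₑ ≤ Γ y) →
      (∫⁻ ξ, ‖𝓕 G ξ‖ₑ ^ (2 * s / (s - 1))) ^ (1 / (2 * s / (s - 1))) ≤
        C * (∫⁻ x in Set.Ioc 0 (2 * π), g x ^ (2 * s / (3 - s))) ^ (1 / (2 * s / (3 - s))) := by
  obtain ⟨C₁, hC₁⟩ := lintegral_lconvolution_rpow_le hs hs2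
  obtain ⟨C₂, hC₂⟩ := lintegral_enorm_fourier_rpow_le (V := Plane) hs hs2
  have hs0 : 0 < s := by linarith
  have hs1 : 0 < s - 1 := by linarith
  have hs3 : 0 < 3 - s := by linarith
  refine ⟨C₂ ^ ((s - 1) / (2 * s)) * C₁ ^ (1 / 2 : ℝ),
    fun g t κ Γ G hg hκ ht hsupp hnorm hΓ hΓ1 hΓ2 hG hGΓ => ?_⟩
  have hΓm : Measurable Γ := by
    rw [funext hΓ]
    exact Measurable.lintegral_prod_right' (f := fun z : Plane × ℝ => g z.2 * κ (z.2, z.1))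
      (by fun_prop)
  set N : Plane → ℝ≥0∞ := fun z => ∫⁻ y, Γ y * Γ (z - y) with hN
  have hNm : Measurable N :=
    Measurable.lintegral_prod_right' (f := fun z : Plane × Plane => Γ z.2 * Γ (z.1 - z.2))
      (by fun_prop)
  have hGi : Integrable G :=
    ⟨hG.aestronglyMeasurable, lt_of_le_of_lt (lintegral_mono hGΓ) hΓ1.lt_top⟩
  -- Together with `hN1` this places `N` in L¹ and L^∞, hence in L^s: the qualitative finiteness
  -- that the convolution estimate requires.
  have hNsup : ∀ z, N z ≤ ∫⁻ y, Γ y ^ (2 : ℝ) := by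
    intro z
    refine (ENNReal.lintegral_mul_le_Lp_mul_Lq volume Real.HolderConjugate.two_two
      hΓm.aemeasurable (hΓm.comp (measurable_const_sub z)).aemeasurable).trans_eq ?_
    simp only [Function.comp_apply]
    rw [lintegral_sub_left_eq_self (fun y => Γ y ^ (2 : ℝ)) z,
      ← ENNReal.rpow_add_of_nonneg _ _ (by norm_num) (by norm_num)]
    norm_num
  have hN1 : ∫⁻ z, N z = (∫⁻ y, Γ y) * ∫⁻ y, Γ y := by
    rw [hN, lintegral_lintegral_swap (by fun_prop), ← lintegral_mul_const _ hΓm]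
    congr 1 with y
    rw [lintegral_const_mul _ (by fun_prop), lintegral_sub_right_eq_self]
  have hNs : ∫⁻ z, N z ^ s ≠ ∞ := by
    refine (lt_of_le_of_lt (lintegral_mono fun z => ?_) (b := ∫⁻ z,
      (∫⁻ y, Γ y ^ (2 : ℝ)) ^ (s - 1) * N z) ?_).ne
    · conv_lhs => rw [show s = (s - 1) + 1 by ring]
      rw [ENNReal.rpow_add_of_nonneg _ _ hs1.le zero_le_one, ENNReal.rpow_one]
      gcongr
      exact hNsup z
    · rw [lintegral_const_mul _ hNm, hN1]
      exact ENNReal.mul_lt_top (ENNReal.rpow_ne_top_of_nonneg hs1.le hΓ2).lt_top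
        (ENNReal.mul_lt_top hΓ1.lt_top hΓ1.lt_top)
  set u : Plane → ℂ := convolution G G (ContinuousLinearMap.mul ℂ ℂ) volume with hu
  have hui : Integrable u := hGi.integrable_convolution _ hGi
  have hum : Measurable u := by
    refine (StronglyMeasurable.integral_prod_right' (f := fun z : Plane × Plane =>
      G z.2 * G (z.1 - z.2)) ?_).measurable
    exact Measurable.stronglyMeasurable (by fun_prop)
  have huN : ∀ z, ‖u z‖ₑ ≤ N z := by
    intro z
    refine (enorm_integral_le_lintegral_enorm _).trans (lintegral_mono fun y => ?_)
    rw [ContinuousLinearMap.mul_apply', enorm_mul]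
    exact mul_le_mul' (hGΓ _) (hGΓ _)
  have hus : ∫⁻ z, ‖u z‖ₑ ^ s ≤ ∫⁻ z, N z ^ s :=
    lintegral_mono fun z => ENNReal.rpow_le_rpow (huN z) hs0.le
  -- The transform of `G * G` is the square of that of `G`; this halves the exponent `2 * s / (s -
  -- 1)` and brings it to the Hausdorff–Young dual of `s`.
  have hsq : ∫⁻ ξ, ‖𝓕 G ξ‖ₑ ^ (2 * s / (s - 1)) = ∫⁻ ξ, ‖𝓕 u ξ‖ₑ ^ (s / (s - 1)) := by
    congr 1 with ξ
    rw [hu, Real.fourier_mul_convolution_eq hGi hGi, enorm_mul, ← sq, ← ENNReal.rpow_two,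
      ← ENNReal.rpow_mul, mul_div_assoc]
  have h1 := hC₁ g t κ Γ hg hκ ht hsupp hnorm hΓ hNs
  set W := ∫⁻ x in Set.Ioc 0 (2 * π), g x ^ (2 * s / (3 - s))
  calc (∫⁻ ξ, ‖𝓕 G ξ‖ₑ ^ (2 * s / (s - 1))) ^ (1 / (2 * s / (s - 1)))
      ≤ (C₂ * (∫⁻ z, N z ^ s) ^ (1 / (s - 1))) ^ ((s - 1) / (2 * s)) := by
        rw [hsq, one_div_div]
        gcongr
        refine (hC₂ u hum hui (ne_top_of_le_ne_top hNs hus)).trans ?_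
        gcongr
    _ = C₂ ^ ((s - 1) / (2 * s)) * ((∫⁻ z, N z ^ s) ^ (1 / s)) ^ (1 / 2 : ℝ) := by
        rw [ENNReal.mul_rpow_of_nonneg _ _ (by positivity), ← ENNReal.rpow_mul, ← ENNReal.rpow_mul]
        congr 2
        field_simp
    _ ≤ C₂ ^ ((s - 1) / (2 * s)) * (C₁ * W ^ ((3 - s) / s)) ^ (1 / 2 : ℝ) := by
        gcongr
    _ = _ := by
        rw [ENNReal.mul_rpow_of_nonneg _ _ (by positivity), ← ENNReal.rpow_mul, ENNReal.coe_mul,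
          ENNReal.coe_rpow_of_nonneg _ (by positivity), ENNReal.coe_rpow_of_nonneg _ (by positivity),
          mul_assoc, one_div_div, show (3 - s) / s * (1 / 2) = (3 - s) / (2 * s) by field_simp]

end DualEstimate

/-! ### The linearized maximal operator, by duality. -/

section Linearized

open Real

/-- The quadratic mean of `F` over the ball `B(x, t)`. -/
noncomputable def quadraticMean (F : Plane → ℂ) (x : Plane) (t : ℝ) : ℝ≥0∞ :=
  ((∫⁻ y in Metric.ball x t, ‖F y‖ₑ ^ (2 : ℝ)) / volume (Metric.ball x t)) ^ (1 / 2 : ℝ)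

theorem measurableSet_mem_ball {α : Type*} [MeasurableSpace α] {c : α → Plane} {ρ : α → ℝ}
    (hc : Measurable c) (hρ : Measurable ρ) :
    MeasurableSet {z : α × Plane | z.2 ∈ Metric.ball (c z.1) (ρ z.1)} := by
  simp only [Metric.mem_ball]
  exact measurableSet_lt (measurable_snd.dist (hc.comp measurable_fst)) (hρ.comp measurable_fst)

theorem measurable_setLIntegral_ball {α : Type*} [MeasurableSpace α] {c : α → Plane} {ρ : α → ℝ}
    (hc : Measurable c) (hρ : Measurable ρ) {h : Plane → ℝ≥0∞} (hh : Measurable h) :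
    Measurable fun a => ∫⁻ y in Metric.ball (c a) (ρ a), h y := by
  have h1 := Measurable.lintegral_prod_right' (ν := (volume : Measure Plane))
    (f := {z : α × Plane | z.2 ∈ Metric.ball (c z.1) (ρ z.1)}.indicator fun z => h z.2)
    ((hh.comp measurable_snd).indicator (measurableSet_mem_ball hc hρ))
  convert! h1 using 2 with a
  rw [← lintegral_indicator measurableSet_ball]
  rfl

theorem measurable_volume_ball {α : Type*} [MeasurableSpace α] {c : α → Plane} {ρ : α → ℝ}
    (hc : Measurable c) (hρ : Measurable ρ) :
    Measurable fun a => volume (Metric.ball (c a) (ρ a)) := by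
  simpa using measurable_setLIntegral_ball hc hρ (h := fun _ => 1) measurable_const

theorem measurable_quadraticMean {α : Type*} [MeasurableSpace α] {c : α → Plane} {ρ : α → ℝ}
    (hc : Measurable c) (hρ : Measurable ρ) {F : Plane → ℂ} (hF : Measurable F) :
    Measurable fun a => quadraticMean F (c a) (ρ a) :=
  ((measurable_setLIntegral_ball hc hρ (by fun_prop)).div (measurable_volume_ball hc hρ)).pow_const _

/-- Restriction estimate for quadratic means with a measurable choice of radii. -/
theorem lintegral_quadraticMean_rpow_le {s : ℝ} (hs : 1 < s) (hs2 : s < 2) : ∃ C : ℝ≥0,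
    ∀ f : Plane → ℂ, MemLp f (ENNReal.ofReal (2 * s / (s + 1))) →
    ∀ (ρ : ℝ → ℝ) (δ : ℝ), Measurable ρ → 0 < δ → (∀ θ, δ ≤ ρ θ) →
      (∫⁻ θ in Set.Ioc 0 (2 * π), quadraticMean (fourierPlane f) (circlePoint θ) (ρ θ) ^
        (2 * s / (3 * (s - 1)))) ^ (1 / (2 * s / (3 * (s - 1)))) ≤
      C * (∫⁻ x, ‖f x‖ₑ ^ (2 * s / (s + 1))) ^ (1 / (2 * s / (s + 1))) := by
  obtain ⟨C, hC⟩ := lintegral_enorm_fourier_rpow_le_of_le_superposition hs hs2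
  refine ⟨C, fun f hf ρ δ hρ hδ hρδ => ?_⟩
  have hs0 : 0 < s := by linarith
  have hs1 : 0 < s - 1 := by linarith
  have hs3 : 0 < 3 - s := by linarith
  set p : ℝ := 2 * s / (s + 1) with hp
  set q : ℝ := 2 * s / (3 * (s - 1)) with hq
  have hq1 : 0 < q - 1 := by
    rw [hq, sub_pos, one_lt_div (by positivity)]; linarith
  have hp1 : 1 ≤ ENNReal.ofReal p := by
    rw [← ENNReal.ofReal_one]
    refine ENNReal.ofReal_le_ofReal ?_
    rw [hp, le_div_iff₀ (by positivity)]; linarith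
  have hp2 : ENNReal.ofReal p ≤ 2 := by
    rw [show (2 : ℝ≥0∞) = ENNReal.ofReal 2 by simp]
    refine ENNReal.ofReal_le_ofReal ?_
    rw [hp, div_le_iff₀ (by positivity)]; linarith
  have hpc : p.HolderConjugate (2 * s / (s - 1)) := by
    refine Real.holderConjugate_iff.2 ⟨?_, ?_⟩
    · rw [hp, one_lt_div (by positivity)]; linarith
    · rw [hp]; field_simp; ring
  set F := fourierPlane f
  have hFm : Measurable F := measurable_fourierPlane hp1 ENNReal.ofReal_ne_top hf
  obtain ⟨B, hB⟩ := setLIntegral_ball_fourierPlane_le hp1 hp2 hf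
  have hρ0 : ∀ θ, 0 < ρ θ := fun θ => hδ.trans_le (hρδ θ)
  set I : Set ℝ := Set.Ioc 0 (2 * π) with hI
  have hIfin : volume I ≠ ∞ := by rw [hI, Real.volume_Ioc]; exact ENNReal.ofReal_ne_top
  set v : ℝ → ℝ≥0∞ := fun θ => volume (Metric.ball (circlePoint θ) (ρ θ)) with hv
  have hvm : Measurable v := measurable_volume_ball measurable_circlePoint hρ
  have hv0 : ∀ θ, v θ ≠ 0 := fun θ => (Metric.measure_ball_pos volume _ (hρ0 θ)).ne'
  have hvt : ∀ θ, v θ ≠ ∞ := fun θ => measure_ball_lt_top.ne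
  set d : ℝ≥0∞ := (volume (Metric.ball (0 : Plane) δ))⁻¹ with hd
  have hdt : d ≠ ∞ := ENNReal.inv_ne_top.2 (Metric.measure_ball_pos volume _ hδ).ne'
  have hvd : ∀ θ, (v θ)⁻¹ ≤ d := by
    intro θ
    refine ENNReal.inv_le_inv.2 ?_
    rw [← Measure.addHaar_ball_center volume (circlePoint θ)]
    exact measure_mono (Metric.ball_subset_ball (hρδ θ))
  set A : ℝ → ℝ≥0∞ := fun θ => quadraticMean F (circlePoint θ) (ρ θ) with hA
  have hAm : Measurable A := measurable_quadraticMean measurable_circlePoint hρ hFm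
  have hA2 : ∀ θ, ∫⁻ y in Metric.ball (circlePoint θ) (ρ θ), ‖F y‖ₑ ^ (2 : ℝ) =
      A θ ^ (2 : ℝ) * v θ := by
    intro θ
    simp only [hA, quadraticMean]
    rw [← ENNReal.rpow_mul, show (1 / 2 : ℝ) * 2 = 1 by norm_num, ENNReal.rpow_one,
      ENNReal.div_mul_cancel (hv0 θ) (hvt θ)]
  -- A uniform bound for the means, available because the radii stay above `δ`. It serves finiteness
  -- only; neither `δ` nor `M` enters the final constant.
  set M : ℝ≥0∞ := (B + B * d) ^ (1 / 2 : ℝ) with hM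
  have hMt : M ≠ ∞ := ENNReal.rpow_ne_top_of_nonneg (by norm_num)
    (ENNReal.add_ne_top.2 ⟨ENNReal.coe_ne_top, ENNReal.mul_ne_top ENNReal.coe_ne_top hdt⟩)
  have hAM : ∀ θ, A θ ≤ M := by
    intro θ
    refine ENNReal.rpow_le_rpow ?_ (by norm_num)
    refine (ENNReal.div_le_div_right (hB (circlePoint θ) (ρ θ)) _).trans ?_
    rw [ENNReal.add_div, ENNReal.mul_div_cancel_right (hv0 θ) (hvt θ), div_eq_mul_inv]
    gcongr
    exact hvd θ
  have hAt : ∀ θ, A θ ≠ ∞ := fun θ => ne_top_of_le_ne_top hMt (hAM θ)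
  -- The extremizer for L^q duality: `g * A = A ^ q`, and `g` raised to the conjugate exponent `2 *
  -- s / (3 - s)` is again `A ^ q`.
  set g : ℝ → ℝ≥0∞ := fun θ => A θ ^ (q - 1) with hg
  have hgm : Measurable g := hAm.pow_const _
  set T : Set (ℝ × Plane) := {z | z.2 ∈ Metric.ball (circlePoint z.1) (ρ z.1)} with hT
  have hTm : MeasurableSet T := measurableSet_mem_ball measurable_circlePoint hρ
  -- Normalized so that `κ = ‖F‖ₑ * ω` has L² norm squared at most `1 / v θ` and pairs with `‖F‖ₑ`
  -- to `A θ`. If `A θ = 0`, then `ω` is infinite on the ball, but both integrals vanish by `0 * ∞ =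
  -- 0`.
  set ω : ℝ × Plane → ℝ≥0∞ := T.indicator fun z => (v z.1 * A z.1)⁻¹ with hω
  have hωm : Measurable ω :=
    (((hvm.mul hAm).inv).comp measurable_fst).indicator hTm
  set κ : ℝ × Plane → ℝ≥0∞ := fun z => ‖F z.2‖ₑ * ω z with hκ
  have hκm : Measurable κ := (hFm.enorm.comp measurable_snd).mul hωm
  have hωint : ∀ (h : Plane → ℝ≥0∞) (a : ℝ), 0 < a → Measurable h → ∀ θ,
      ∫⁻ y, h y * ω (θ, y) ^ a =
        (∫⁻ y in Metric.ball (circlePoint θ) (ρ θ), h y) * ((v θ * A θ)⁻¹) ^ a := by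
    intro h a ha hh θ
    rw [← lintegral_mul_const _ hh, ← lintegral_indicator measurableSet_ball]
    congr 1 with y
    by_cases hy : y ∈ Metric.ball (circlePoint θ) (ρ θ)
    · rw [Set.indicator_of_mem hy, hω, Set.indicator_of_mem (show (θ, y) ∈ T from hy)]
    · rw [Set.indicator_of_notMem hy, hω, Set.indicator_of_notMem (show (θ, y) ∉ T from hy),
        ENNReal.zero_rpow_of_pos ha, mul_zero]
  have hsupp : ∀ θ, ∀ y ∉ Metric.ball (circlePoint θ) (ρ θ), κ (θ, y) = 0 := by
    intro θ y hy
    simp only [hκ, hω]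
    rw [Set.indicator_of_notMem (show (θ, y) ∉ T from hy), mul_zero]
  have hnorm : ∀ θ, ∫⁻ y, κ (θ, y) ^ (2 : ℝ) ≤ (v θ)⁻¹ := by
    intro θ
    simp only [hκ, ENNReal.mul_rpow_of_nonneg _ _ (zero_le_two : (0 : ℝ) ≤ 2)]
    rw [hωint (fun y => ‖F y‖ₑ ^ (2 : ℝ)) 2 two_pos (by fun_prop), hA2]
    by_cases h0 : A θ = 0
    · rw [h0, ENNReal.zero_rpow_of_pos two_pos, zero_mul, zero_mul]; exact zero_le
    · refine le_of_eq ?_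
      rw [ENNReal.mul_inv (Or.inl (hv0 θ)) (Or.inl (hvt θ)), ENNReal.rpow_two, ENNReal.rpow_two]
      calc A θ ^ 2 * v θ * ((v θ)⁻¹ * (A θ)⁻¹) ^ 2
          = (v θ * (v θ)⁻¹) * (A θ * (A θ)⁻¹) ^ 2 * (v θ)⁻¹ := by ring
        _ = (v θ)⁻¹ := by
          rw [ENNReal.mul_inv_cancel (hv0 θ) (hvt θ), ENNReal.mul_inv_cancel h0 (hAt θ), one_pow,
            one_mul, one_mul]
  have hFω : ∀ θ, ∫⁻ y, ‖F y‖ₑ * κ (θ, y) = A θ := by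
    intro θ
    have := hωint (fun y => ‖F y‖ₑ ^ (2 : ℝ)) 1 one_pos (by fun_prop) θ
    simp only [ENNReal.rpow_one] at this
    have e : ∀ y, ‖F y‖ₑ * κ (θ, y) = ‖F y‖ₑ ^ (2 : ℝ) * ω (θ, y) := by
      intro y
      rw [hκ, ENNReal.rpow_two, sq, mul_assoc]
    simp only [e]
    rw [this, hA2]
    by_cases h0 : A θ = 0
    · rw [h0, ENNReal.zero_rpow_of_pos two_pos, zero_mul, zero_mul]
    · rw [ENNReal.mul_inv (Or.inl (hv0 θ)) (Or.inl (hvt θ)), ENNReal.rpow_two, sq]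
      calc A θ * A θ * v θ * ((v θ)⁻¹ * (A θ)⁻¹)
          = (v θ * (v θ)⁻¹) * (A θ * (A θ)⁻¹) * A θ := by ring
        _ = A θ := by
          rw [ENNReal.mul_inv_cancel (hv0 θ) (hvt θ), ENNReal.mul_inv_cancel h0 (hAt θ), one_mul,
            one_mul]
  set Γ : Plane → ℝ≥0∞ := fun y => ∫⁻ θ in I, g θ * κ (θ, y) with hΓ
  set w : Plane → ℝ≥0∞ := fun y => ∫⁻ θ in I, g θ * ω (θ, y) with hw
  have hΓm : Measurable Γ :=
    Measurable.lintegral_prod_right' (f := fun z : Plane × ℝ => g z.2 * κ (z.2, z.1)) (by fun_prop)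
  have hwm : Measurable w :=
    Measurable.lintegral_prod_right' (f := fun z : Plane × ℝ => g z.2 * ω (z.2, z.1)) (by fun_prop)
  have hΓw : ∀ y, Γ y = ‖F y‖ₑ * w y := by
    intro y
    rw [hw, ← lintegral_const_mul _ (by fun_prop)]
    simp only [hΓ, hκ]
    congr 1 with θ
    ring
  have hgfin : ∀ a : ℝ, 0 ≤ a → ∫⁻ θ in I, A θ ^ a ≠ ∞ := by
    intro a ha
    refine (lt_of_le_of_lt (lintegral_mono fun θ => ENNReal.rpow_le_rpow (hAM θ) ha) ?_).ne
    rw [setLIntegral_const]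
    exact ENNReal.mul_lt_top (ENNReal.rpow_ne_top_of_nonneg ha hMt).lt_top hIfin.lt_top
  have hΓ1 : ∫⁻ y, Γ y ≠ ∞ := by
    refine (lt_of_le_of_lt ?_ (hgfin (q - 1) hq1.le).lt_top).ne
    rw [hΓ, lintegral_lintegral_swap (by fun_prop)]
    refine lintegral_mono fun θ => ?_
    rw [lintegral_const_mul _ (by fun_prop)]
    refine (mul_le_mul_right (lintegral_le_one_of_lintegral_sq_le (hρ0 θ) (by fun_prop)
      (hsupp θ) (hnorm θ)) _).trans_eq (mul_one _)
  have hΓ2 : ∫⁻ y, Γ y ^ (2 : ℝ) ≠ ∞ := by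
    have h1 : ∀ y, Γ y ^ (2 : ℝ) ≤ (∫⁻ θ in I, g θ ^ (2 : ℝ)) * ∫⁻ θ in I, κ (θ, y) ^ (2 : ℝ) := by
      intro y
      refine (ENNReal.rpow_le_rpow (ENNReal.lintegral_mul_le_Lp_mul_Lq (volume.restrict I)
        Real.HolderConjugate.two_two hgm.aemeasurable (g := fun θ => κ (θ, y)) (by fun_prop))
        zero_le_two).trans_eq ?_
      rw [ENNReal.mul_rpow_of_nonneg _ _ zero_le_two, ← ENNReal.rpow_mul, ← ENNReal.rpow_mul]
      norm_num
    refine (lt_of_le_of_lt (lintegral_mono h1) ?_).ne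
    have hκ2m : Measurable fun y => ∫⁻ θ in I, κ (θ, y) ^ (2 : ℝ) :=
      Measurable.lintegral_prod_right' (f := fun z : Plane × ℝ => κ (z.2, z.1) ^ (2 : ℝ))
        (by fun_prop)
    rw [lintegral_const_mul _ hκ2m]
    refine ENNReal.mul_lt_top ?_ ?_
    · have := hgfin ((q - 1) * 2) (by positivity)
      simp only [ENNReal.rpow_mul] at this
      exact this.lt_top
    · rw [lintegral_lintegral_swap (by fun_prop)]
      refine lt_of_le_of_lt (lintegral_mono fun θ => (hnorm θ).trans (hvd θ)) ?_
      rw [setLIntegral_const]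
      exact ENNReal.mul_lt_top hdt.lt_top hIfin.lt_top
  -- The conjugate makes `F * G` nonnegative, so nothing is lost on passing to the integral that the
  -- multiplication formula transforms. Where `w` is infinite `toReal` returns 0, which matters only
  -- on a null set or where `F` vanishes.
  set G : Plane → ℂ := fun y => (starRingEnd ℂ) (F y) * ((w y).toReal : ℂ) with hG
  have hGm : Measurable G :=
    (Complex.continuous_conj.measurable.comp hFm).mul
      (Complex.measurable_ofReal.comp hwm.ennreal_toReal)
  have hGnorm : ∀ y, ‖G y‖ₑ = ‖F y‖ₑ * ENNReal.ofReal (w y).toReal := by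
    intro y
    rw [hG, enorm_mul, RCLike.enorm_conj, ← ofReal_norm ((w y).toReal : ℂ), Complex.norm_real,
      Real.norm_of_nonneg ENNReal.toReal_nonneg]
  have hGΓ : ∀ y, ‖G y‖ₑ ≤ Γ y := by
    intro y
    rw [hGnorm, hΓw]
    gcongr
    exact ENNReal.ofReal_toReal_le
  have hGΓae : ∀ᵐ y, ‖G y‖ₑ = Γ y := by
    filter_upwards [ae_lt_top hΓm hΓ1] with y hy
    rw [hGnorm, hΓw]
    by_cases h0 : ‖F y‖ₑ = 0
    · rw [h0, zero_mul, zero_mul]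
    · congr 1
      refine ENNReal.ofReal_toReal fun ht => ?_
      rw [hΓw, ht, ENNReal.mul_top h0] at hy
      exact lt_irrefl _ hy
  have hGi : Integrable G :=
    ⟨hGm.aestronglyMeasurable, lt_of_le_of_lt (lintegral_mono hGΓ) hΓ1.lt_top⟩
  have hG2 : MemLp G 2 := by
    refine ⟨hGm.aestronglyMeasurable, ?_⟩
    rw [eLpNorm_lt_top_iff_lintegral_rpow_enorm_lt_top (by norm_num) (by norm_num),
      ENNReal.toReal_ofNat]
    exact lt_of_le_of_lt (lintegral_mono fun y => ENNReal.rpow_le_rpow (hGΓ y) zero_le_two)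
      hΓ2.lt_top
  set X := ∫⁻ θ in I, A θ ^ q with hX
  have hXt : X ≠ ∞ := hgfin q (by linarith)
  have hXΓ : X = ∫⁻ y, ‖F y * G y‖ₑ := by
    calc X = ∫⁻ θ in I, ∫⁻ y, g θ * (‖F y‖ₑ * κ (θ, y)) := by
          refine lintegral_congr fun θ => ?_
          rw [lintegral_const_mul _ (by fun_prop), hFω, hg]
          conv_lhs => rw [show q = (q - 1) + 1 by ring]
          rw [ENNReal.rpow_add_of_nonneg _ _ hq1.le zero_le_one, ENNReal.rpow_one]
      _ = ∫⁻ y, (∫⁻ θ in I, g θ * (‖F y‖ₑ * κ (θ, y))) := lintegral_lintegral_swap (by fun_prop)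
      _ = ∫⁻ y, ‖F y‖ₑ * Γ y := by
          refine lintegral_congr fun y => ?_
          rw [hΓ, ← lintegral_const_mul _ (by fun_prop)]
          refine lintegral_congr fun θ => ?_
          ring
      _ = _ := by
          refine lintegral_congr_ae ?_
          filter_upwards [hGΓae] with y hy
          rw [enorm_mul, hy]
  have hpos : ∀ y, F y * G y = ((‖F y‖ ^ 2 * (w y).toReal : ℝ) : ℂ) := by
    intro y
    rw [hG, ← mul_assoc, Complex.mul_conj']
    push_cast
    rfl
  have hXdual : X ≤ ∫⁻ x, ‖f x‖ₑ * ‖𝓕 G x‖ₑ := by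
    have hi : Integrable fun y => ‖F y‖ ^ 2 * (w y).toReal := by
      refine ⟨by fun_prop, ?_⟩
      have : ∫⁻ y, ‖‖F y‖ ^ 2 * (w y).toReal‖ₑ = X := by
        rw [hXΓ]
        refine lintegral_congr fun y => ?_
        rw [hpos, ← ofReal_norm, ← ofReal_norm, Complex.norm_real]
      rw [HasFiniteIntegral, this]
      exact hXt.lt_top
    have hnn : ∀ y, 0 ≤ ‖F y‖ ^ 2 * (w y).toReal := fun y => by positivity
    have e1 : X = ‖∫ y, F y * G y‖ₑ := by
      simp only [hpos]
      rw [integral_complex_ofReal, ← ofReal_norm, Complex.norm_real,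
        Real.norm_of_nonneg (integral_nonneg hnn),
        ofReal_integral_eq_lintegral_ofReal hi (Filter.Eventually.of_forall hnn), hXΓ]
      refine lintegral_congr fun y => ?_
      rw [hpos, ← ofReal_norm, Complex.norm_real, Real.norm_of_nonneg (hnn y)]
    rw [e1, integral_fourierPlane_mul_eq hp1 hp2 hf hGi hG2]
    refine (enorm_integral_le_lintegral_enorm _).trans_eq ?_
    simp only [enorm_mul]
  set P := (∫⁻ x, ‖f x‖ₑ ^ p) ^ (1 / p) with hP
  have hest := hC g ρ κ Γ G hgm hκm hρ0 hsupp hnorm (fun _ => rfl) hΓ1 hΓ2 hGm hGΓ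
  have hgX : ∫⁻ x in I, g x ^ (2 * s / (3 - s)) = X := by
    refine lintegral_congr fun θ => ?_
    rw [hg, ← ENNReal.rpow_mul]
    congr 1
    rw [hq]
    field_simp
    ring
  rw [hgX] at hest
  -- Hölder and the dual estimate return `X` to the power `1 / q'`; dividing by it, with `X` finite,
  -- leaves `X ^ (1 / q)`.
  have hfinal : X ≤ P * (C * X ^ (1 / (2 * s / (3 - s)))) := by
    refine hXdual.trans ((ENNReal.lintegral_mul_le_Lp_mul_Lq volume hpc hf.1.enorm
      (continuous_fourier_of_integrable hGi).enorm.measurable.aemeasurable).trans ?_)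
    gcongr
  by_cases hX0 : X = 0
  · rw [hX0, ENNReal.zero_rpow_of_pos (by positivity)]; exact zero_le
  have hXr0 : X ^ (1 / (2 * s / (3 - s))) ≠ 0 := by simp [hX0, hXt]
  have hXrt : X ^ (1 / (2 * s / (3 - s))) ≠ ∞ := ENNReal.rpow_ne_top_of_nonneg (by positivity) hXt
  refine (ENNReal.mul_le_mul_iff_left hXr0 hXrt).1 ?_
  rw [← ENNReal.rpow_add _ _ hX0 hXt]
  have hexp : 1 / q + 1 / (2 * s / (3 - s)) = 1 := by
    rw [hq]; field_simp; ring
  rw [hexp, ENNReal.rpow_one]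
  refine hfinal.trans_eq ?_
  ring

end Linearized

/-! ### From arbitrary radii to finitely many dyadic ones, and back to the circle measure. -/

section Dyadic

open Real

theorem quadraticMean_le_two_mul (F : Plane → ℂ) (x : Plane) {t u : ℝ} (ht : 0 < t) (htu : t ≤ u)
    (hu : u ≤ 2 * t) : quadraticMean F x t ≤ 2 * quadraticMean F x u := by
  have hv0 : volume (Metric.ball x t) ≠ 0 := (Metric.measure_ball_pos volume _ ht).ne'
  have hvol : volume (Metric.ball x u) ≤ 4 * volume (Metric.ball x t) := by
    refine (measure_mono (Metric.ball_subset_ball hu)).trans_eq ?_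
    rw [Measure.addHaar_ball_mul_of_pos volume x two_pos, Measure.addHaar_ball_center volume x,
      finrank_euclideanSpace_fin]
    norm_num
  have h4 : (2 : ℝ≥0∞) = 4 ^ (1 / 2 : ℝ) := by
    rw [show (4 : ℝ≥0∞) = 2 ^ (2 : ℝ) by norm_num, ← ENNReal.rpow_mul]
    norm_num
  unfold quadraticMean
  conv_rhs => lhs; rw [h4]
  rw [← ENNReal.mul_rpow_of_nonneg _ _ (by norm_num)]
  refine ENNReal.rpow_le_rpow ?_ (by norm_num)
  calc _ ≤ (∫⁻ y in Metric.ball x u, ‖F y‖ₑ ^ (2 : ℝ)) / volume (Metric.ball x t) :=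
        ENNReal.div_le_div_right (lintegral_mono_set (Metric.ball_subset_ball htu)) _
    _ = 4 * ((∫⁻ y in Metric.ball x u, ‖F y‖ₑ ^ (2 : ℝ)) / (4 * volume (Metric.ball x t))) := by
        rw [← mul_div_assoc, ENNReal.mul_div_mul_left _ _ (by norm_num) (by norm_num)]
    _ ≤ _ := by gcongr

/-- The maximal function of quadratic means over balls of dyadic radius. -/
noncomputable def dyadicQuadraticMaximal (F : Plane → ℂ) (x : Plane) : ℝ≥0∞ :=
  ⨆ k : ℤ, quadraticMean F x (2 ^ k)

theorem measurable_dyadicQuadraticMaximal {F : Plane → ℂ} (hF : Measurable F) :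
    Measurable (dyadicQuadraticMaximal F) :=
  Measurable.iSup fun _ => measurable_quadraticMean measurable_id measurable_const hF

theorem quadraticMean_le_dyadicQuadraticMaximal (F : Plane → ℂ) (x : Plane) {t : ℝ} (ht : 0 < t) :
    quadraticMean F x t ≤ 2 * dyadicQuadraticMaximal F x := by
  obtain ⟨k, hk1, hk2⟩ := exists_mem_Ioc_zpow ht one_lt_two
  refine (quadraticMean_le_two_mul F x ht hk2 ?_).trans ?_
  · rw [zpow_add_one₀ two_ne_zero]; linarith
  · gcongr
    exact le_iSup (fun k : ℤ => quadraticMean F x (2 ^ k)) (k + 1)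

/-- On each ball with normalized measure the mean of order `r ≤ 2` is at most the quadratic mean;
the factor 2 pays for rounding the radius up to a power of two. -/
theorem rMaximal_le_dyadicQuadraticMaximal {r : ℝ} (hr₁ : 1 ≤ r) (hr₂ : r ≤ 2) {F : Plane → ℂ}
    (hF : Measurable F) (x : Plane) : rMaximal r F x ≤ 2 * dyadicQuadraticMaximal F x := by
  have hr0 : 0 < r := by linarith
  rw [rMaximal, one_div, ENNReal.rpow_inv_le_iff hr0]
  refine iSup₂_le fun t ht => ?_
  rw [← ENNReal.rpow_inv_le_iff hr0]
  refine le_trans ?_ (quadraticMean_le_dyadicQuadraticMaximal F x ht)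
  rw [setLAverage_eq']
  set ν : Measure Plane := (volume (Metric.ball x t))⁻¹ • volume.restrict (Metric.ball x t) with hν
  have : IsProbabilityMeasure ν := by
    refine ⟨?_⟩
    rw [hν, Measure.smul_apply, Measure.restrict_apply_univ, smul_eq_mul,
      ENNReal.inv_mul_cancel (Metric.measure_ball_pos volume _ ht).ne' measure_ball_lt_top.ne]
  have h := eLpNorm'_le_eLpNorm'_of_exponent_le hr0 hr₂ ν hF.aestronglyMeasurable
  have h2 : eLpNorm' F 2 ν = quadraticMean F x t := by
    rw [eLpNorm', quadraticMean, hν, lintegral_smul_measure, smul_eq_mul, ENNReal.div_eq_inv_mul]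
  have h1 : eLpNorm' F r ν = (∫⁻ y, ‖‖F y‖ ^ r‖ₑ ∂ν) ^ r⁻¹ := by
    rw [eLpNorm', one_div]
    congr 2 with y
    rw [Real.enorm_rpow_of_nonneg (norm_nonneg _) hr0.le, enorm_norm]
  rwa [← h1, ← h2]

/-- A maximum of finitely many means is attained, and comparing them one at a time selects a
maximizing radius measurably. Finitely many values also give the positive lower bound `δ`. -/
theorem exists_measurable_radius_quadraticMean_eq_partialSups {F : Plane → ℂ} (hF : Measurable F)
    {c : ℝ → Plane} (hc : Measurable c) {R : ℕ → ℝ} (hR : ∀ n, 0 < R n) (N : ℕ) :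
    ∃ (ρ : ℝ → ℝ) (δ : ℝ), Measurable ρ ∧ 0 < δ ∧ (∀ θ, δ ≤ ρ θ) ∧
      ∀ θ, partialSups (fun n θ => quadraticMean F (c θ) (R n)) N θ =
        quadraticMean F (c θ) (ρ θ) := by
  induction N with
  | zero => exact ⟨fun _ => R 0, R 0, measurable_const, hR 0, fun _ => le_rfl, fun _ => by simp⟩
  | succ N ih =>
    obtain ⟨ρ, δ, hρ, hδ, hρδ, h⟩ := ih
    classical
    have hm : MeasurableSet {θ | quadraticMean F (c θ) (ρ θ) ≤
        quadraticMean F (c θ) (R (N + 1))} :=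
      measurableSet_le (measurable_quadraticMean hc hρ hF)
        (measurable_quadraticMean hc measurable_const hF)
    refine ⟨fun θ => if quadraticMean F (c θ) (ρ θ) ≤ quadraticMean F (c θ) (R (N + 1)) then
      R (N + 1) else ρ θ, min δ (R (N + 1)), Measurable.ite hm measurable_const hρ,
      lt_min hδ (hR _), fun θ => ?_, fun θ => ?_⟩
    · dsimp only
      split_ifs
      · exact min_le_right _ _
      · exact (min_le_left _ _).trans (hρδ θ)
    · rw [partialSups_add_one, Pi.sup_apply, h]
      dsimp only
      split_ifs with h1
      · exact sup_eq_right.2 h1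
      · exact sup_eq_left.2 (not_le.1 h1).le

/-- Restriction estimate for the dyadic quadratic maximal function. -/
theorem lintegral_dyadicQuadraticMaximal_rpow_le {s : ℝ} (hs : 1 < s) (hs2 : s < 2) : ∃ C : ℝ≥0,
    ∀ f : Plane → ℂ, MemLp f (ENNReal.ofReal (2 * s / (s + 1))) →
      (∫⁻ θ in Set.Ioc 0 (2 * π), dyadicQuadraticMaximal (fourierPlane f) (circlePoint θ) ^
        (2 * s / (3 * (s - 1)))) ^ (1 / (2 * s / (3 * (s - 1)))) ≤
      C * (∫⁻ x, ‖f x‖ₑ ^ (2 * s / (s + 1))) ^ (1 / (2 * s / (s + 1))) := by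
  obtain ⟨C, hC⟩ := lintegral_quadraticMean_rpow_le hs hs2
  refine ⟨C, fun f hf => ?_⟩
  have hs1 : 0 < s - 1 := by linarith
  set q : ℝ := 2 * s / (3 * (s - 1)) with hq
  have hq0 : 0 < q := by positivity
  have hp1 : 1 ≤ ENNReal.ofReal (2 * s / (s + 1)) := by
    rw [← ENNReal.ofReal_one]
    refine ENNReal.ofReal_le_ofReal ?_
    rw [le_div_iff₀ (by positivity)]; linarith
  set F := fourierPlane f
  have hF : Measurable F := measurable_fourierPlane hp1 ENNReal.ofReal_ne_top hf
  set R : ℕ → ℝ := fun n => 2 ^ Equiv.intEquivNat.symm n with hR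
  have hR0 : ∀ n, 0 < R n := fun n => by positivity
  set u : ℕ → ℝ → ℝ≥0∞ := fun n θ => quadraticMean F (circlePoint θ) (R n) with hu
  have hum : ∀ N, Measurable (partialSups u N) := by
    intro N
    obtain ⟨ρ, δ, hρ, -, -, h⟩ :=
      exists_measurable_radius_quadraticMean_eq_partialSups hF measurable_circlePoint hR0 N
    rw [show partialSups u N = _ from funext h]
    exact measurable_quadraticMean measurable_circlePoint hρ hF
  have hS : ∀ θ, dyadicQuadraticMaximal F (circlePoint θ) ^ q = ⨆ N, partialSups u N θ ^ q := by
    intro θ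
    have h1 : dyadicQuadraticMaximal F (circlePoint θ) = ⨆ N, partialSups u N θ := by
      rw [dyadicQuadraticMaximal, ← Equiv.intEquivNat.symm.iSup_comp, ← iSup_apply,
        iSup_partialSups_eq, iSup_apply]
    rw [h1]
    exact (ENNReal.orderIsoRpow q hq0).map_iSup _
  rw [one_div, ENNReal.rpow_inv_le_iff hq0]
  simp only [hS]
  -- Monotone convergence in the number of radii: the linearized bound has a constant independent of
  -- `N`, `ρ` and `δ`.
  rw [lintegral_iSup (fun N => (hum N).pow_const q)
    fun M N h θ => ENNReal.rpow_le_rpow ((partialSups u).monotone h θ) hq0.le]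
  refine iSup_le fun N => ?_
  obtain ⟨ρ, δ, hρ, hδ, hρδ, h⟩ :=
    exists_measurable_radius_quadraticMean_eq_partialSups hF measurable_circlePoint hR0 N
  rw [← ENNReal.rpow_inv_le_iff hq0, ← one_div]
  simp only [show partialSups u N = _ from funext h]
  exact hC f hf ρ δ hρ hδ hρδ

theorem circleMeasure_eq_map_circlePoint :
    circleMeasure = Measure.map circlePoint (volume.restrict (Set.Ioc 0 (2 * π))) := rfl

theorem circleMeasure_univ : circleMeasure Set.univ = ENNReal.ofReal (2 * π) := by
  rw [circleMeasure_eq_map_circlePoint, Measure.map_apply measurable_circlePoint MeasurableSet.univ,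
    Set.preimage_univ, Measure.restrict_apply_univ, Real.volume_Ioc, sub_zero]

/-- Since `2 * π ≥ 1`, one factor serves all exponents `a ≤ 1`; this makes the final constant
independent of `q`. -/
theorem circleMeasure_univ_rpow_le {a : ℝ} (ha : a ≤ 1) :
    circleMeasure Set.univ ^ a ≤ ENNReal.ofReal (2 * π) := by
  rw [circleMeasure_univ]
  refine (ENNReal.rpow_le_rpow_of_exponent_le ?_ ha).trans_eq (ENNReal.rpow_one _)
  rw [ENNReal.one_le_ofReal]
  linarith [pi_gt_three]

theorem rMaximal_le_of_ae_enorm_le {r : ℝ} (hr : 0 < r) {h : Plane → ℂ} {B : ℝ≥0∞}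
    (hB : ∀ᵐ y, ‖h y‖ₑ ≤ B) (x : Plane) : rMaximal r h x ≤ B := by
  rw [rMaximal, one_div, ENNReal.rpow_inv_le_iff hr]
  refine iSup₂_le fun t ht => ?_
  have : ∫⁻ y in Metric.ball x t, ‖‖h y‖ ^ r‖ₑ ≤ B ^ r * volume (Metric.ball x t) := by
    rw [← setLIntegral_const]
    refine lintegral_mono_ae (ae_restrict_of_ae ?_)
    filter_upwards [hB] with y hy
    rw [Real.enorm_rpow_of_nonneg (norm_nonneg _) hr.le, enorm_norm]
    exact ENNReal.rpow_le_rpow hy hr.le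
  rw [setLAverage_eq]
  exact ENNReal.div_le_of_le_mul this

/-- The endpoint where `q = ∞` is allowed: averages of a function bounded by the L¹ norm of `f` obey
the same bound. -/
theorem eLpNorm_rMaximal_fourierPlane_one_le {r : ℝ} (hr : 0 < r) {q : ℝ≥0∞} (hq : 1 ≤ q)
    {f : Plane → ℂ} (hf : MemLp f 1) :
    eLpNorm (rMaximal r (fourierPlane f)) q circleMeasure ≤
      ENNReal.ofReal (2 * π) * eLpNorm f 1 := by
  have hB : ∀ᵐ y, ‖fourierPlane f y‖ₑ ≤ eLpNorm f 1 := by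
    filter_upwards [fourierPlane_ae_eq (memLp_one_iff_integrable.1 hf)] with y hy
    rw [hy, eLpNorm_one_eq_lintegral_enorm]
    exact enorm_fourier_le f y
  have h := eLpNorm_le_of_ae_enorm_bound (p := q) (μ := circleMeasure)
    (f := rMaximal r (fourierPlane f)) (C := eLpNorm f 1)
    (Filter.Eventually.of_forall fun x => by
      simpa using rMaximal_le_of_ae_enorm_le hr hB x)
  refine h.trans ?_
  rw [smul_eq_mul, mul_comm]
  gcongr
  refine circleMeasure_univ_rpow_le ?_
  rcases eq_or_ne q ∞ with rfl | hqt
  · simp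
  · exact inv_le_one_of_one_le₀ ((ENNReal.toReal_one).symm.trans_le
      (ENNReal.toReal_mono hqt hq))

/-- The critical exponent comes from the dyadic estimate; smaller `q` follow by Hölder on the
circle, which has finite measure. -/
theorem eLpNorm_rMaximal_fourierPlane_le {r : ℝ} (hr₁ : 1 ≤ r) (hr₂ : r ≤ 2) {s : ℝ} (hs : 1 < s)
    (hs2 : s < 2) : ∃ C : ℝ≥0, ∀ q : ℝ≥0∞, 1 ≤ q → q ≤ ENNReal.ofReal (2 * s / (3 * (s - 1))) →
      ∀ f : Plane → ℂ, MemLp f (ENNReal.ofReal (2 * s / (s + 1))) →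
        eLpNorm (rMaximal r (fourierPlane f)) q circleMeasure ≤
          C * eLpNorm f (ENNReal.ofReal (2 * s / (s + 1))) := by
  obtain ⟨C, hC⟩ := lintegral_dyadicQuadraticMaximal_rpow_le hs hs2
  refine ⟨2 * C * (2 * π).toNNReal, fun q hq hqs f hf => ?_⟩
  have hs1 : 0 < s - 1 := by linarith
  have hq0 : 0 < 2 * s / (3 * (s - 1)) := by positivity
  have hp0 : 0 < 2 * s / (s + 1) := by positivity
  have hp1 : 1 ≤ ENNReal.ofReal (2 * s / (s + 1)) := by
    rw [← ENNReal.ofReal_one]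
    refine ENNReal.ofReal_le_ofReal ?_
    rw [le_div_iff₀ (by positivity)]; linarith
  set F := fourierPlane f
  have hF : Measurable F := measurable_fourierPlane hp1 ENNReal.ofReal_ne_top hf
  have hSm := measurable_dyadicQuadraticMaximal hF
  have hS : eLpNorm (dyadicQuadraticMaximal F) (ENNReal.ofReal (2 * s / (3 * (s - 1))))
      circleMeasure ≤ C * eLpNorm f (ENNReal.ofReal (2 * s / (s + 1))) := by
    rw [circleMeasure_eq_map_circlePoint,
      eLpNorm_map_measure hSm.aestronglyMeasurable measurable_circlePoint.aemeasurable,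
      eLpNorm_eq_lintegral_rpow_enorm_toReal (by simpa using hq0) ENNReal.ofReal_ne_top,
      eLpNorm_eq_lintegral_rpow_enorm_toReal (by simpa using hp0) ENNReal.ofReal_ne_top,
      ENNReal.toReal_ofReal hq0.le, ENNReal.toReal_ofReal hp0.le]
    simpa using! hC f hf
  calc eLpNorm (rMaximal r F) q circleMeasure
      ≤ eLpNorm (fun x => 2 * dyadicQuadraticMaximal F x) q circleMeasure :=
        eLpNorm_mono_enorm fun x => by
          simpa using rMaximal_le_dyadicQuadraticMaximal hr₁ hr₂ hF x
    _ ≤ eLpNorm (fun x => 2 * dyadicQuadraticMaximal F x)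
          (ENNReal.ofReal (2 * s / (3 * (s - 1)))) circleMeasure *
            ENNReal.ofReal (2 * π) := by
        refine (eLpNorm_le_eLpNorm_mul_rpow_measure_univ hqs
          (hSm.const_mul 2).aestronglyMeasurable).trans ?_
        gcongr
        refine circleMeasure_univ_rpow_le ?_
        have h1 : 1 ≤ q.toReal := (ENNReal.toReal_one).symm.trans_le
          (ENNReal.toReal_mono (ne_top_of_le_ne_top ENNReal.ofReal_ne_top hqs) hq)
        have h2 : 1 / q.toReal ≤ 1 := (div_le_one (by linarith)).2 h1
        have h3 : 0 ≤ 1 / (ENNReal.ofReal (2 * s / (3 * (s - 1)))).toReal := by positivity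
        linarith
    _ = 2 * eLpNorm (dyadicQuadraticMaximal F)
          (ENNReal.ofReal (2 * s / (3 * (s - 1)))) circleMeasure * ENNReal.ofReal (2 * π) := by
        congr 1
        rw [eLpNorm_eq_lintegral_rpow_enorm_toReal (by simpa using hq0) ENNReal.ofReal_ne_top,
          eLpNorm_eq_lintegral_rpow_enorm_toReal (by simpa using hq0) ENNReal.ofReal_ne_top,
          ENNReal.toReal_ofReal hq0.le]
        simp only [enorm_eq_self, ENNReal.mul_rpow_of_nonneg _ _ hq0.le]
        rw [lintegral_const_mul _ (hSm.pow_const _), ENNReal.mul_rpow_of_nonneg _ _ (by positivity),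
          ← ENNReal.rpow_mul, mul_one_div_cancel hq0.ne', ENNReal.rpow_one]
    _ ≤ 2 * (C * eLpNorm f (ENNReal.ofReal (2 * s / (s + 1)))) * ENNReal.ofReal (2 * π) := by
        gcongr
    _ = _ := by
        rw [ENNReal.coe_mul, ENNReal.coe_mul, ENNReal.coe_ofNat, ← ENNReal.ofReal]
        ring

end Dyadic

/-! ### Conversion of exponents and conclusion. -/

theorem theorem2 (r : ℝ) (hr₁ : 1 ≤ r) (hr₂ : r ≤ 2)
    (p p' : ℝ≥0∞) (hp₁ : 1 ≤ p) (hp₂ : p < 4 / 3) (hpp' : p.HolderConjugate p') :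
    ∃ C : ℝ≥0, ∀ q : ℝ≥0∞, 1 ≤ q → 3 * q ≤ p' →
      ∀ f : Plane → ℂ, MemLp f p volume →
        eLpNorm (rMaximal r (fourierPlane f)) q circleMeasure ≤ C * eLpNorm f p volume := by
  rcases hp₁.eq_or_lt with rfl | hp1
  · exact ⟨(2 * Real.pi).toNNReal, fun q hq _ f hf =>
      eLpNorm_rMaximal_fourierPlane_one_le (by linarith) hq hf⟩
  lift p to ℝ≥0 using hp₂.ne_top
  have hp1r : (1 : ℝ) < p := by exact_mod_cast hp1
  have hp2r : (p : ℝ) < 4 / 3 := by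
    have := (ENNReal.toReal_lt_toReal ENNReal.coe_ne_top
      (ENNReal.div_ne_top (by norm_num) (by norm_num))).2 hp₂
    simpa using this
  have h2p : (0 : ℝ) < 2 - p := by linarith
  have hs1 : 1 < (p : ℝ) / (2 - p) := by rw [one_lt_div h2p]; linarith
  have hs2 : (p : ℝ) / (2 - p) < 2 := by rw [div_lt_iff₀ h2p]; linarith
  -- The inverse of `p = 2 * s / (s + 1)`; the interval `1 < p < 4 / 3` corresponds to `1 < s < 2`,
  -- and `p' / 3` to `2 * s / (3 * (s - 1))`.
  set s : ℝ := p / (2 - p) with hs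
  have hps : ENNReal.ofReal (2 * s / (s + 1)) = p := by
    rw [show 2 * s / (s + 1) = p by rw [hs]; field_simp; ring, ENNReal.ofReal_coe_nnreal]
  obtain ⟨C, hC⟩ := eLpNorm_rMaximal_fourierPlane_le hr₁ hr₂ hs1 hs2
  rw [hps] at hC
  refine ⟨C, fun q hq hqp f hf => hC q hq ?_ f hf⟩
  have hp0 : (0 : ℝ) < p - 1 := by linarith
  have hp't : p' ≠ ∞ := by
    have := hpp'.symm
    exact (ENNReal.HolderConjugate.ne_top_iff_ne_one p' p).2 hp1.ne'
  lift p' to ℝ≥0 using hp't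
  have hqt : q ≠ ∞ := by
    rintro rfl
    simp at hqp
  have h0 : (p : ℝ)⁻¹ + (p' : ℝ)⁻¹ = 1 := by
    have h := congrArg ENNReal.toReal (ENNReal.HolderConjugate.inv_add_inv_eq_one (p : ℝ≥0∞) p')
    rwa [ENNReal.toReal_add (ENNReal.inv_ne_top.2 (ENNReal.HolderConjugate.ne_zero _ (p' : ℝ≥0∞)))
      (ENNReal.inv_ne_top.2 (ENNReal.HolderConjugate.ne_zero _ (p : ℝ≥0∞))), ENNReal.toReal_inv,
      ENNReal.toReal_inv, ENNReal.toReal_one] at h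
  have h1 : 2 * s / (3 * (s - 1)) = p' / 3 := by
    have h2 : (p' : ℝ) = p / (p - 1) := by
      rw [← inv_inv (p' : ℝ), ← inv_div, inv_inj, sub_div, div_self (by linarith), one_div]
      linarith
    rw [h2, hs, div_sub_one h2p.ne', show (p : ℝ) - (2 - p) = 2 * (p - 1) by ring]
    field_simp
  rw [ENNReal.le_ofReal_iff_toReal_le hqt (by rw [h1]; positivity), h1]
  have h3 := ENNReal.toReal_mono ENNReal.coe_ne_top hqp
  rw [ENNReal.toReal_mul, ENNReal.toReal_ofNat, ENNReal.coe_toReal] at h3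
  linarith
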